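/- Let $n\ge 8$. Let $O_n(\mathbb Z)$ be the hyperoctahedral group of orthogonal $n\times n$ matrices with integer entries; the homomorphism $\Sigma_n\ltimes\mathbb F_2^n\to O_n(\mathbb Z)$ given by permutation matrices and diagonal sign matrices is an isomorphism. Let $(\mathbb F_2^n)^{ev}\subset\mathbb F_2^n$ be the subgroup of vectors with an even number of entries equal to $1$. Let $F_n$ be the group of Clifford words, generated by symbols $e_1,\dots,e_n$ and a central element $-1$ with $(-1)^2=1$, subject to $e_i^2=-1$ and $e_ie_j=-e_je_i$ for $i\neq j$, and let $F_n^{ev}\subset F_n$ be the subgroup of words with an even number of symbols $e_i$. Let $\widetilde A_n$ be the spin extension of the alternating group $A_n$, that is, the preimage of $A_n\subset SO(n)$ in $Spin(n)$; it acts on $F_n^{ev}$ through $A_n$ by permuting the symbols. Then the arithmetic Whitehead tower of $O_n(\mathbb Z)$, in which one first forms the commutator subgroup and then, this subgroup being perfect, its universal central extension, starts with $$O_n(\mathbb Z)\longleftarrow A_n\ltimes(\mathbb F_2^n)^{ev}\xleftarrow{\ (\mathbb Z/2)^2\ }\widetilde A_n\ltimes F_n^{ev}.$$ Explicitly: the first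 map, the restriction of the above isomorphism, is injective with image the commutator subgroup of $O_n(\mathbb Z)$; the group $A_n\ltimes(\mathbb F_2^n)^{ev}$ is perfect; and the second map, given by $\widetilde A_n\to A_n$ and by $F_n^{ev}\to(\mathbb F_2^n)^{ev}$, $-1\mapsto 0$, $e_ie_j\mapsto e_i+e_j$, is a universal central extension with kernel isomorphic to $(\mathbb Z/2)^2$. -/

import Mathlib

namespace HyperoctahedralTower

/-! ### Central extensions -/

/-- The action on an invariant subgroup induced by an action by group automorphisms. -/
def restrictAction {N G : Type*} [Group N] [Group G] (φ : G →* MulAut N) (S : Subgroup N)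
    (h : ∀ g, ∀ x ∈ S, φ g x ∈ S) : G →* MulAut S where
  toFun g :=
    { toFun := fun x => ⟨φ g x, h g x x.2⟩
      invFun := fun x => ⟨φ g⁻¹ x, h g⁻¹ x x.2⟩
      left_inv := fun x => by ext; simp
      right_inv := fun x => by ext; simp
      map_mul' := fun x y => by ext; simp }
  map_one' := by ext x; simp
  map_mul' a b := by ext x; simp

/-- `p : E → G` is a central extension of `G`. -/
def IsCentralExtension {E G : Type*} [Group E] [Group G] (p : E →* G) : Prop :=
  Function.Surjective p ∧ p.ker ≤ Subgroup.center E

/-- `p : E → G` is a universal central extension (Schur extension) of `G`: it is a central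
extension and has exactly one map over `G` to each central extension of `G`. -/
def IsUniversalCentralExtension.{u, v, w} {E : Type u} {G : Type v} [Group E] [Group G]
    (p : E →* G) : Prop :=
  IsCentralExtension p ∧
    ∀ (X : Type w) [Group X] (q : X →* G), IsCentralExtension q →
      ∃! f : E →* X, q.comp f = p

/-- The diagram `G ← H ← K` given by `i : H → G` and `p : K → H` consists of the first terms of
the arithmetic Whitehead tower of `G`: `i` identifies `H` with the commutator subgroup of `G`,
this subgroup is perfect, and `p` is its universal central extension. -/
def IsWhiteheadTowerStart.{t, u, v, w} {G : Type t} {H : Type u} {K : Type v}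
    [Group G] [Group H] [Group K] (i : H →* G) (p : K →* H) : Prop :=
  Function.Injective i ∧ i.range = commutator G ∧ Group.IsPerfect H ∧
    IsUniversalCentralExtension.{v, u, w} p

/-! ### Signed permutations -/

/-- The group `𝔽₂ⁿ`, written multiplicatively. -/
abbrev BinaryWords (n : ℕ) : Type := Multiplicative (Fin n → ZMod 2)

/-- The action of `Σₙ` on `𝔽₂ⁿ` with `σ • eⱼ = e_{σ j}`. -/
def permBinary (n : ℕ) : Equiv.Perm (Fin n) →* MulAut (BinaryWords n) where
  toFun σ :=
    { toFun := fun v => Multiplicative.ofAdd fun i => v.toAdd (σ⁻¹ i)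
      invFun := fun v => Multiplicative.ofAdd fun i => v.toAdd (σ i)
      left_inv := fun v => by
        apply Multiplicative.toAdd.injective; funext i; simp
      right_inv := fun v => by
        apply Multiplicative.toAdd.injective; funext i; simp
      map_mul' := fun v w => rfl }
  map_one' := rfl
  map_mul' σ τ := rfl

/-- The sum of the coordinates, `𝔽₂ⁿ → 𝔽₂`. -/
def coordSum (n : ℕ) : BinaryWords n →* Multiplicative (ZMod 2) where
  toFun v := Multiplicative.ofAdd (∑ i, v.toAdd i)
  map_one' := by simp
  map_mul' v w := by simp [Finset.sum_add_distrib]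

/-- `(𝔽₂ⁿ)ᵉᵛ`, the vectors with an even number of entries equal to `1`. -/
def evenBinary (n : ℕ) : Subgroup (BinaryWords n) := (coordSum n).ker

theorem coordSum_permBinary (n : ℕ) (σ : Equiv.Perm (Fin n)) (v : BinaryWords n) :
    coordSum n (permBinary n σ v) = coordSum n v :=
  congrArg Multiplicative.ofAdd (Equiv.sum_comp σ⁻¹ fun i => v.toAdd i)

theorem permBinary_mem_even (n : ℕ) (σ : Equiv.Perm (Fin n)) :
    ∀ v ∈ evenBinary n, permBinary n σ v ∈ evenBinary n := by
  intro v hv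
  rw [evenBinary, MonoidHom.mem_ker] at hv ⊢
  rw [coordSum_permBinary, hv]

/-- `Σₙ ⋉ 𝔽₂ⁿ`, the group of signed permutations. -/
abbrev SignedPerm (n : ℕ) : Type := BinaryWords n ⋊[permBinary n] Equiv.Perm (Fin n)

/-- The action of `Aₙ` on `(𝔽₂ⁿ)ᵉᵛ` by permutation of the coordinates. -/
def altBinary (n : ℕ) : alternatingGroup (Fin n) →* MulAut (evenBinary n) :=
  (restrictAction (permBinary n) (evenBinary n) (permBinary_mem_even n)).comp
    (alternatingGroup (Fin n)).subtype

/-- `Aₙ ⋉ (𝔽₂ⁿ)ᵉᵛ`, the group of evenly signed even permutations. -/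
abbrev EvenSignedAlt (n : ℕ) : Type := evenBinary n ⋊[altBinary n] alternatingGroup (Fin n)

/-- The inclusion of the evenly signed even permutations into the signed permutations. -/
def evenSignedInclusion (n : ℕ) : EvenSignedAlt n →* SignedPerm n :=
  SemidirectProduct.map (evenBinary n).subtype (alternatingGroup (Fin n)).subtype
    (fun _ => rfl)

/-- The sign `(-1)ᵃ` of `a ∈ 𝔽₂`. -/
def sgn (a : ZMod 2) : ℤ := (-1) ^ a.val

theorem sgn_add (a b : ZMod 2) : sgn (a + b) = sgn a * sgn b := by
  revert a b; decide

theorem sgn_mul_self (a : ZMod 2) : sgn a * sgn a = 1 := by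
  revert a; decide

/-- The matrix of the signed permutation `(v, σ)`, with `eⱼ ↦ (-1)^{v_{σ j}} e_{σ j}`. It is the
product of the diagonal matrix with entries `(-1)^{vᵢ}` and the permutation matrix of `σ`. -/
def signedMatrix (n : ℕ) (g : SignedPerm n) : Matrix (Fin n) (Fin n) ℤ :=
  Matrix.of fun i j => if i = g.right j then sgn (g.left.toAdd i) else 0

theorem signedMatrix_one (n : ℕ) : signedMatrix n 1 = 1 := by
  ext i j
  by_cases h : i = j <;> simp [signedMatrix, Matrix.one_apply, h, sgn]

theorem signedMatrix_mul (n : ℕ) (g h : SignedPerm n) :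
    signedMatrix n (g * h) = signedMatrix n g * signedMatrix n h := by
  ext i j
  rw [Matrix.mul_apply, Finset.sum_eq_single (h.right j)]
  · by_cases hi : i = g.right (h.right j)
    · subst hi
      have : (permBinary n g.right h.left).toAdd (g.right (h.right j))
          = h.left.toAdd (h.right j) :=
        congrArg h.left.toAdd (g.right.symm_apply_apply (h.right j))
      simp [signedMatrix, sgn_add, this]
    · simp [signedMatrix, hi]
  · intro k _ hk
    simp [signedMatrix, hk]
  · simp

theorem signedMatrix_mem (n : ℕ) (g : SignedPerm n) :
    signedMatrix n g ∈ Matrix.orthogonalGroup (Fin n) ℤ := by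
  rw [Matrix.mem_orthogonalGroup_iff']
  ext i j
  rw [Matrix.mul_apply, Finset.sum_eq_single (g.right i)]
  · by_cases h : i = j
    · subst h
      simp [signedMatrix, sgn_mul_self]
    · simp [signedMatrix, h]
  · intro k _ hk
    simp [signedMatrix, hk]
  · simp

/-- The homomorphism from `Σₙ ⋉ 𝔽₂ⁿ` to `Oₙ(ℤ)` given by permutation matrices and diagonal
sign matrices. -/
def toOrthogonal (n : ℕ) : SignedPerm n →* Matrix.orthogonalGroup (Fin n) ℤ where
  toFun g := ⟨signedMatrix n g, signedMatrix_mem n g⟩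
  map_one' := Subtype.ext (signedMatrix_one n)
  map_mul' g h := Subtype.ext (signedMatrix_mul n g h)

/-! ### Clifford words -/

/-- The defining relations of the group of Clifford words. The symbol `none` stands for `-1` and
the symbol `some i` for `eᵢ`. The relations say that `-1` is a central element with square `1`,
and that `eᵢ² = -1` and `eᵢ eⱼ = - eⱼ eᵢ` for `i ≠ j`. -/
inductive CliffordRel (n : ℕ) : FreeGroup (Option (Fin n)) → Prop
  | neg_sq : CliffordRel n (FreeGroup.of none ^ 2)
  | neg_central (i : Fin n) : CliffordRel n
      (FreeGroup.of none * FreeGroup.of (some i) *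
        (FreeGroup.of (some i) * FreeGroup.of none)⁻¹)
  | sq (i : Fin n) : CliffordRel n (FreeGroup.of (some i) ^ 2 * (FreeGroup.of none)⁻¹)
  | anticomm (i j : Fin n) (h : i ≠ j) : CliffordRel n
      (FreeGroup.of (some i) * FreeGroup.of (some j) *
        (FreeGroup.of none * (FreeGroup.of (some j) * FreeGroup.of (some i)))⁻¹)

/-- `Fₙ`, the group of Clifford words. -/
abbrev CliffordWords (n : ℕ) : Type := PresentedGroup {r | CliffordRel n r}

/-- The central element `-1` of `Fₙ`. -/
def negOne (n : ℕ) : CliffordWords n := PresentedGroup.of none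

/-- The Clifford symbol `eᵢ` in `Fₙ`. -/
def symbol {n : ℕ} (i : Fin n) : CliffordWords n := PresentedGroup.of (some i)

theorem negOne_sq (n : ℕ) : negOne n ^ 2 = 1 :=
  PresentedGroup.one_of_mem (CliffordRel.neg_sq (n := n))

theorem negOne_comm {n : ℕ} (i : Fin n) : negOne n * symbol i = symbol i * negOne n :=
  PresentedGroup.mk_eq_mk_of_mul_inv_mem (CliffordRel.neg_central i)

theorem symbol_sq {n : ℕ} (i : Fin n) : symbol i ^ 2 = negOne n :=
  PresentedGroup.mk_eq_mk_of_mul_inv_mem (CliffordRel.sq i)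

theorem symbol_anticomm {n : ℕ} (i j : Fin n) (h : i ≠ j) :
    symbol i * symbol j = negOne n * (symbol j * symbol i) :=
  PresentedGroup.mk_eq_mk_of_mul_inv_mem (CliffordRel.anticomm i j h)

/-- The universal property of `Fₙ`: a homomorphism out of `Fₙ` is given by the images `z` of `-1`
and `f i` of `eᵢ`, subject to the relations. -/
def cliffordLift {n : ℕ} {G : Type*} [Group G] (z : G) (f : Fin n → G) (h1 : z ^ 2 = 1)
    (h2 : ∀ i, z * f i = f i * z) (h3 : ∀ i, f i ^ 2 = z)
    (h4 : ∀ i j, i ≠ j → f i * f j = z * (f j * f i)) : CliffordWords n →* G :=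
  PresentedGroup.toGroup (f := fun o : Option (Fin n) => o.elim z f) (by
    rintro r (_ | i | i | ⟨i, j, h⟩)
    · simpa using h1
    · simp [h2]
    · simp [h3]
    · have e := h4 i j h
      simp [e]
      simp only [← mul_inv_rev, mul_inv_cancel])

theorem cliffordLift_negOne {n : ℕ} {G : Type*} [Group G] (z : G) (f : Fin n → G)
    (h1 h2 h3 h4) : cliffordLift z f h1 h2 h3 h4 (negOne n) = z :=
  FreeGroup.lift_apply_of

theorem cliffordLift_symbol {n : ℕ} {G : Type*} [Group G] (z : G) (f : Fin n → G)
    (h1 h2 h3 h4) (i : Fin n) : cliffordLift z f h1 h2 h3 h4 (symbol i) = f i :=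
  FreeGroup.lift_apply_of

theorem cliffordHom_ext {n : ℕ} {G : Type*} [Group G] {f g : CliffordWords n →* G}
    (h0 : f (negOne n) = g (negOne n)) (h1 : ∀ i, f (symbol i) = g (symbol i)) : f = g := by
  apply PresentedGroup.ext
  rintro (_ | i)
  · exact h0
  · exact h1 i

/-- The endomorphism of `Fₙ` that fixes `-1` and maps `eᵢ` to `e_{σ i}`. -/
def permCliffordHom {n : ℕ} (σ : Equiv.Perm (Fin n)) : CliffordWords n →* CliffordWords n :=
  cliffordLift (negOne n) (fun i => symbol (σ i)) (negOne_sq n) (fun _ => negOne_comm _)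
    (fun _ => symbol_sq _) (fun _ _ h => symbol_anticomm _ _ (σ.injective.ne h))

@[simp] theorem permCliffordHom_negOne {n : ℕ} (σ : Equiv.Perm (Fin n)) :
    permCliffordHom σ (negOne n) = negOne n :=
  cliffordLift_negOne _ _ _ _ _ _

@[simp] theorem permCliffordHom_symbol {n : ℕ} (σ : Equiv.Perm (Fin n)) (i : Fin n) :
    permCliffordHom σ (symbol i) = symbol (σ i) :=
  cliffordLift_symbol _ _ _ _ _ _ _

theorem permCliffordHom_one (n : ℕ) :
    permCliffordHom (1 : Equiv.Perm (Fin n)) = MonoidHom.id _ :=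
  cliffordHom_ext (by simp) (by simp)

theorem permCliffordHom_mul {n : ℕ} (σ τ : Equiv.Perm (Fin n)) :
    permCliffordHom (σ * τ) = (permCliffordHom σ).comp (permCliffordHom τ) :=
  cliffordHom_ext (by simp) (by simp)

/-- The action of `Σₙ` on `Fₙ` by permutation of the symbols, `σ • eᵢ = e_{σ i}`. -/
def permClifford (n : ℕ) : Equiv.Perm (Fin n) →* MulAut (CliffordWords n) where
  toFun σ :=
    (permCliffordHom σ).toMulEquiv (permCliffordHom σ⁻¹)
      (by rw [← permCliffordHom_mul, inv_mul_cancel, permCliffordHom_one])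
      (by rw [← permCliffordHom_mul, mul_inv_cancel, permCliffordHom_one])
  map_one' := by ext x; exact DFunLike.congr_fun (permCliffordHom_one n) x
  map_mul' σ τ := by ext x; exact DFunLike.congr_fun (permCliffordHom_mul σ τ) x

/-- The projection `Fₙ → 𝔽₂ⁿ` that maps `-1` to `0` and `eᵢ` to the `i`-th basis vector. -/
def wordClass (n : ℕ) : CliffordWords n →* BinaryWords n :=
  cliffordLift 1 (fun i => Multiplicative.ofAdd (Pi.single i 1)) (one_pow 2)
    (fun i => by simp)
    (fun i => by
      apply Multiplicative.toAdd.injective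
      simp only [toAdd_pow, toAdd_ofAdd, toAdd_one]
      funext k
      exact CharTwo.two_nsmul (R := ZMod 2) _)
    (fun i j _ => by rw [one_mul, mul_comm])

@[simp] theorem wordClass_negOne (n : ℕ) : wordClass n (negOne n) = 1 :=
  cliffordLift_negOne _ _ _ _ _ _

@[simp] theorem wordClass_symbol {n : ℕ} (i : Fin n) :
    wordClass n (symbol i) = Multiplicative.ofAdd (Pi.single i 1) :=
  cliffordLift_symbol _ _ _ _ _ _ _

theorem wordClass_permClifford (n : ℕ) (σ : Equiv.Perm (Fin n)) (x : CliffordWords n) :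
    wordClass n (permClifford n σ x) = permBinary n σ (wordClass n x) := by
  suffices h : (wordClass n).comp (permCliffordHom σ)
      = (permBinary n σ).toMonoidHom.comp (wordClass n) from DFunLike.congr_fun h x
  refine cliffordHom_ext (by simp) fun i => ?_
  simp only [MonoidHom.comp_apply, permCliffordHom_symbol, wordClass_symbol]
  apply Multiplicative.toAdd.injective
  funext k
  change (Pi.single (σ i) 1 : Fin n → ZMod 2) k = (Pi.single i 1 : Fin n → ZMod 2) (σ⁻¹ k)
  simp only [Pi.single_apply, Equiv.Perm.inv_eq_iff_eq]

/-- `Fₙᵉᵛ`, the group of even Clifford words: those with an even number of symbols `eᵢ`. -/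
def evenClifford (n : ℕ) : Subgroup (CliffordWords n) := (evenBinary n).comap (wordClass n)

theorem permClifford_mem_even (n : ℕ) (σ : Equiv.Perm (Fin n)) :
    ∀ x ∈ evenClifford n, permClifford n σ x ∈ evenClifford n := by
  intro x hx
  rw [evenClifford, Subgroup.mem_comap] at hx ⊢
  rw [wordClass_permClifford]
  exact permBinary_mem_even n σ _ hx

/-- The projection `Fₙᵉᵛ → (𝔽₂ⁿ)ᵉᵛ`. -/
def evenWordClass (n : ℕ) : evenClifford n →* evenBinary n :=
  ((wordClass n).comp (evenClifford n).subtype).codRestrict (evenBinary n) fun x => x.2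

/-! ### The spin extension of the alternating group -/

/-- The negative definite standard quadratic form on `ℝⁿ`, so that `eᵢ² = -1` in its Clifford
algebra. -/
def stdForm (n : ℕ) : QuadraticForm ℝ (Fin n → ℝ) :=
  QuadraticMap.weightedSumSquares ℝ fun _ : Fin n => (-1 : ℝ)

/-- The basis vector `eᵢ` in the Clifford algebra of `ℝⁿ`. -/
noncomputable def cliffordBasis {n : ℕ} (i : Fin n) : CliffordAlgebra (stdForm n) :=
  CliffordAlgebra.ι (stdForm n) (Pi.single i 1)

/-- The spin extension `Ãₙ`: the preimage of `Aₙ ⊆ SO(n)` under the double cover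
`Spin(n) → SO(n)`, as the group of pairs `(x, σ)` in `Spin(n) × Aₙ` such that `x` acts on `ℝⁿ` by
the permutation matrix of `σ`, that is, `x eᵢ x⁻¹ = e_{σ i}`. -/
def SpinAlt (n : ℕ) : Subgroup (spinGroup (stdForm n) × alternatingGroup (Fin n)) where
  carrier := {p | ∀ i, (p.1 : CliffordAlgebra (stdForm n)) * cliffordBasis i
    = cliffordBasis ((p.2 : Equiv.Perm (Fin n)) i) * p.1}
  one_mem' := fun i => by simp
  mul_mem' := fun {p q} hp hq i => by
    have h1 := hq i
    have h2 := hp ((q.2 : Equiv.Perm (Fin n)) i)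
    simp only [Prod.fst_mul, Prod.snd_mul, Subgroup.coe_mul, Equiv.Perm.mul_apply,
      Submonoid.coe_mul]
    rw [mul_assoc, h1, ← mul_assoc, h2, mul_assoc]
  inv_mem' := fun {p} hp i => by
    have h := hp (((p.2 : Equiv.Perm (Fin n))⁻¹) i)
    have e1 : ((p.1⁻¹ : spinGroup (stdForm n)) : CliffordAlgebra (stdForm n)) * p.1 = 1 := by
      rw [← Submonoid.coe_mul, inv_mul_cancel, Submonoid.coe_one]
    have e2 : (p.1 : CliffordAlgebra (stdForm n)) * (p.1⁻¹ : spinGroup (stdForm n)) = 1 := by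
      rw [← Submonoid.coe_mul, mul_inv_cancel, Submonoid.coe_one]
    rw [show (p.2 : Equiv.Perm (Fin n)) (((p.2 : Equiv.Perm (Fin n))⁻¹) i) = i from
      (p.2 : Equiv.Perm (Fin n)).apply_symm_apply i] at h
    simp only [Prod.fst_inv, Prod.snd_inv, Subgroup.coe_inv]
    calc _ = ((p.1⁻¹ : spinGroup (stdForm n)) : CliffordAlgebra (stdForm n)) *
          (cliffordBasis i * p.1) * (p.1⁻¹ : spinGroup (stdForm n)) := by
            rw [mul_assoc, mul_assoc, e2, mul_one]
      _ = _ := by rw [← h, ← mul_assoc, e1, one_mul]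

/-- The covering `Ãₙ → Aₙ`. -/
def spinAltProj (n : ℕ) : SpinAlt n →* alternatingGroup (Fin n) :=
  (MonoidHom.snd _ _).comp (SpinAlt n).subtype

/-- The action of `Ãₙ` on `Fₙᵉᵛ`: through `Aₙ`, by permutation of the symbols. -/
def spinAltClifford (n : ℕ) : SpinAlt n →* MulAut (evenClifford n) :=
  ((restrictAction (permClifford n) (evenClifford n) (permClifford_mem_even n)).comp
    (alternatingGroup (Fin n)).subtype).comp (spinAltProj n)

/-- `Ãₙ ⋉ Fₙᵉᵛ`. -/
abbrev SpinEvenClifford (n : ℕ) : Type := evenClifford n ⋊[spinAltClifford n] SpinAlt n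

/-- The projection of `Ãₙ ⋉ Fₙᵉᵛ` to `Aₙ ⋉ (𝔽₂ⁿ)ᵉᵛ` given by `Fₙᵉᵛ → (𝔽₂ⁿ)ᵉᵛ` and `Ãₙ → Aₙ`. -/
def towerProj (n : ℕ) : SpinEvenClifford n →* EvenSignedAlt n :=
  SemidirectProduct.map (evenWordClass n) (spinAltProj n) (fun g => by
    refine MonoidHom.ext fun x => Subtype.ext ?_
    exact (wordClass_permClifford n ((spinAltProj n g : Equiv.Perm (Fin n))) x))

end HyperoctahedralTower

universe w

open HyperoctahedralTower

/-! Write G for Aₙ ⋉ (𝔽₂ⁿ)ᵉᵛ and E for Ãₙ ⋉ Fₙᵉᵛ. The lower part of the tower is elementary. An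
integral unit vector is ± a basis vector, so integral orthogonal matrices are signed permutations.
The sign of the permutation and the coordinate sum are characters that cut out G, and G is perfect,
so G is the commutator subgroup.

The heart is that E → G is universal. The plan is to show that every central extension Y of G
contains a canonical subgroup K that covers G and has a kernel of order at most four. If i is fixed
by a subgroup of Aₙ that centralizes a vector or permutation v(i), conjugation by lifts of this
subgroup multiplies a lift of v(i) by central factors. This is a homomorphism to an abelian group,
hence trivial if the subgroup is perfect. The pointwise stabilizer of three points is an alternating
group on n - 3 ≥ 5 points, which is where n ≥ 8 enters. So 3-cycles and vectors eᵢ + eⱼ have lifts T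
and S that are equivariant under conjugation (`exists_equivariant_lift_embedding`).

Every relation between these lifts that holds in G holds in Y up to a central constant that is
independent of the indices, by multiple transitivity. After rescaling, only two constants survive
(`exists_threeCycle_lifts`, `exists_threeCycle_constant`, `exists_pair_lifts`): z = (T i a b * T j a
b)², the square of a lift of a double transposition, and c, the commutator of lifts of eᵢ + eⱼ and
eⱼ + eₖ. Both have square 1. Carmichael's presentation of the alternating group (generators xᵢ,
relations xᵢ³ = (xᵢxⱼ)² = 1) and the obvious presentation of an elementary abelian 2-group then
bound the kernel of K by {1, z, c, zc} (`exists_covering_subgroup`).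

In E the constants z and c are the spin -1 and the Clifford -1. They are independent, and they
exhaust the kernel because an even central element of the Clifford algebra is a scalar and because
Fₙ has only ±1 over 0. For a central extension X of G, apply the above to Y = X ×_G E. Then K → E is
injective since z and c stay independent in E, and surjective since E is perfect. Its inverse
followed by Y → X is the required map (`exists_lift_towerProj`). It is unique because E is perfect.
-/

namespace HyperoctahedralTower

open scoped commutatorElement

/-! ### Words in generators and relations -/

section Words

variable {G : Type*} [Group G]

/-- The cycle `a ↦ b ↦ c ↦ a`. -/
def threeCycle {α : Type*} [DecidableEq α] (a b c : α) : Equiv.Perm α :=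
  Equiv.swap a b * Equiv.swap b c

section ThreeCycle

variable {α : Type*} [DecidableEq α] {a b c : α}

theorem threeCycle_apply_left (hab : a ≠ b) (hac : a ≠ c) : threeCycle a b c a = b := by
  simp [threeCycle, Equiv.swap_apply_of_ne_of_ne hab hac]

theorem threeCycle_apply_mid (hac : a ≠ c) (hbc : b ≠ c) : threeCycle a b c b = c := by
  simp [threeCycle, Equiv.swap_apply_of_ne_of_ne hac.symm hbc.symm]

theorem threeCycle_apply_right : threeCycle a b c c = a := by
  simp [threeCycle]

theorem threeCycle_apply_of_ne {x : α} (ha : x ≠ a) (hb : x ≠ b) (hc : x ≠ c) :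
    threeCycle a b c x = x := by
  simp [threeCycle, Equiv.swap_apply_of_ne_of_ne, *]

theorem threeCycle_inv : (threeCycle a b c)⁻¹ = threeCycle c b a := by
  simp [threeCycle, Equiv.swap_comm]

end ThreeCycle

/-- Elements with `xᵢ³ = 1` and `(xᵢ xⱼ)² = 1` over the 3-cycles `(i a b)` generate a group that
is faithfully represented by permutations. -/
theorem eq_one_of_mem_closure_threeCycles {α : Type*} [DecidableEq α] (π : G →* Equiv.Perm α)
    {a b : α} (x : α → G) (F : Finset α) (ha : a ∉ F) (hb : b ∉ F)
    (h3 : ∀ i ∈ F, x i ^ 3 = 1) (h2 : ∀ i ∈ F, ∀ j ∈ F, i ≠ j → (x i * x j) ^ 2 = 1)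
    (hπ : ∀ i ∈ F, π (x i) = threeCycle i a b) :
    ∀ w ∈ Subgroup.closure (x '' F), π w = 1 → w = 1 := by
  induction F using Finset.induction_on with
  | empty => intro w hw _; simpa using hw
  | insert p F hp ih =>
    have ih' := ih (fun h => ha (Finset.mem_insert_of_mem h))
      (fun h => hb (Finset.mem_insert_of_mem h))
      (fun i hi => h3 i (Finset.mem_insert_of_mem hi))
      (fun i hi j hj => h2 i (Finset.mem_insert_of_mem hi) j (Finset.mem_insert_of_mem hj))
      (fun i hi => hπ i (Finset.mem_insert_of_mem hi))
    have hpa : p ≠ a := fun h => ha (h ▸ Finset.mem_insert_self p F)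
    have hpb : p ≠ b := fun h => hb (h ▸ Finset.mem_insert_self p F)
    set H := Subgroup.closure (x '' F) with hH
    set y := x p with hy
    have hsq : ∀ {u : G}, u ^ 3 = 1 → u * u = u⁻¹ := fun {u} h => by
      rw [eq_inv_iff_mul_eq_one, ← h, pow_succ, pow_two]
    have hyy : y * y = y⁻¹ := hsq (h3 p (Finset.mem_insert_self p F))
    have hxx : ∀ i ∈ F, x i * x i = (x i)⁻¹ := fun i hi =>
      hsq (h3 i (Finset.mem_insert_of_mem hi))
    have hflip : ∀ {u v : G}, (u * v) ^ 2 = 1 → u * v = v⁻¹ * u⁻¹ := fun {u v} h => by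
      rw [← mul_inv_rev, eq_inv_iff_mul_eq_one, ← pow_two, h]
    have hxy : ∀ i ∈ F, x i * y = y⁻¹ * (x i)⁻¹ := fun i hi =>
      hflip (h2 i (Finset.mem_insert_of_mem hi) p (Finset.mem_insert_self p F)
        (fun h => hp (h ▸ hi)))
    have hyx : ∀ i ∈ F, y * x i = (x i)⁻¹ * y⁻¹ := fun i hi =>
      hflip (h2 p (Finset.mem_insert_self p F) i (Finset.mem_insert_of_mem hi)
        (fun h => hp (h ▸ hi)))
    have hxj : ∀ i ∈ F, ∀ j ∈ F, i ≠ j → x i * x j = (x j)⁻¹ * (x i)⁻¹ := fun i hi j hj h =>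
      hflip (h2 i (Finset.mem_insert_of_mem hi) j (Finset.mem_insert_of_mem hj) h)
    have hmem : ∀ i ∈ F, x i ∈ H := fun i hi => Subgroup.subset_closure ⟨i, hi, rfl⟩
    -- The cosets of H that should exhaust the enlarged group: 1, y, y⁻¹ and xᵢ y⁻¹ send p to p, a,
    -- b and i respectively. Left multiplication by each generator permutes these cosets, so P holds
    -- for every word. The image of p then tells the cosets apart.
    let P : G → Prop := fun w => w ∈ H ∨ (∃ h ∈ H, w = y * h) ∨ (∃ h ∈ H, w = y⁻¹ * h) ∨
      ∃ i ∈ F, ∃ h ∈ H, w = x i * y⁻¹ * h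
    have hconj : ∀ j ∈ F, (x j)⁻¹ * y = x j * y⁻¹ * (x j)⁻¹ := fun j hj => by
      rw [← hxx j hj, mul_assoc, hxy j hj, mul_assoc, hxx j hj]
    have step : ∀ g ∈ x '' (insert p F : Finset α), ∀ w, P w → P (g * w) := by
      rintro g ⟨i, hi, rfl⟩ w hw
      rcases Finset.mem_insert.1 hi with rfl | hi
      · rcases hw with hw | ⟨h, hh, rfl⟩ | ⟨h, hh, rfl⟩ | ⟨j, hj, h, hh, rfl⟩
        · exact Or.inr (Or.inl ⟨w, hw, rfl⟩)
        · exact Or.inr (Or.inr (Or.inl ⟨h, hh, by rw [← hyy, mul_assoc]⟩))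
        · exact Or.inl (by simpa [hy] using hh)
        · refine Or.inr (Or.inr (Or.inr ⟨j, hj, (x j)⁻¹ * h,
            H.mul_mem (H.inv_mem (hmem j hj)) hh, ?_⟩))
          calc y * (x j * y⁻¹ * h) = (y * x j) * y⁻¹ * h := by group
            _ = (x j)⁻¹ * (y * y)⁻¹ * h := by rw [hyx j hj]; group
            _ = ((x j)⁻¹ * y) * h := by rw [hyy, inv_inv]
            _ = _ := by rw [hconj j hj]; group
      · rcases hw with hw | ⟨h, hh, rfl⟩ | ⟨h, hh, rfl⟩ | ⟨j, hj, h, hh, rfl⟩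
        · exact Or.inl (H.mul_mem (hmem i hi) hw)
        · exact Or.inr (Or.inr (Or.inl ⟨(x i)⁻¹ * h, H.mul_mem (H.inv_mem (hmem i hi)) hh, by
            rw [← mul_assoc, hxy i hi, mul_assoc]⟩))
        · exact Or.inr (Or.inr (Or.inr ⟨i, hi, h, hh, by rw [mul_assoc]⟩))
        · by_cases hij : i = j
          · subst hij
            refine Or.inr (Or.inl ⟨x i * h, H.mul_mem (hmem i hi) hh, ?_⟩)
            rw [← mul_assoc, ← mul_assoc, hxx i hi, ← hyx i hi, mul_assoc]
          · refine Or.inr (Or.inr (Or.inr ⟨j, hj, (x j)⁻¹ * x i * h,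
              H.mul_mem (H.mul_mem (H.inv_mem (hmem j hj)) (hmem i hi)) hh, ?_⟩))
            calc x i * (x j * y⁻¹ * h) = (x i * x j) * y⁻¹ * h := by group
              _ = (x j)⁻¹ * ((x i)⁻¹ * y⁻¹) * h := by rw [hxj i hi j hj hij]; group
              _ = ((x j)⁻¹ * y) * x i * h := by rw [← hyx i hi]; group
              _ = _ := by rw [hconj j hj]; group
    have key : ∀ w ∈ Subgroup.closure (x '' (insert p F : Finset α)), P w := by
      intro w hw
      induction hw using Subgroup.closure_induction_left with
      | one => exact Or.inl H.one_mem
      | mul_left g hg w _ hw => exact step g hg w hw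
      | inv_mul_cancel g hg w _ hw =>
        have : g⁻¹ = g * g := by
          obtain ⟨i, hi, rfl⟩ := hg
          exact (hsq (h3 i hi)).symm
        rw [this, mul_assoc]
        exact step g hg _ (step g hg w hw)
    -- H moves only points of F, a and b, so the image of p depends only on the coset. A word with
    -- trivial permutation lies in H, and the induction hypothesis applies.
    have hfix : ∀ h ∈ H, π h p = p := by
      intro h hh
      induction hh using Subgroup.closure_induction with
      | mem g hg =>
        obtain ⟨i, hi, rfl⟩ := hg
        rw [hπ i (Finset.mem_insert_of_mem hi)]
        exact threeCycle_apply_of_ne (fun e => hp (e ▸ hi)) hpa hpb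
      | one => simp
      | mul u v _ _ hu hv => simp [hu, hv]
      | inv u _ hu => rw [map_inv, Equiv.Perm.inv_eq_iff_eq, hu]
    have hyp : π y = threeCycle p a b := hπ p (Finset.mem_insert_self p F)
    have hyb : (π y)⁻¹ p = b := by
      rw [Equiv.Perm.inv_eq_iff_eq, hyp, threeCycle_apply_right]
    intro w hw h1
    rcases key w hw with hw | ⟨h, hh, rfl⟩ | ⟨h, hh, rfl⟩ | ⟨i, hi, h, hh, rfl⟩
    · exact ih' w hw h1
    · have := DFunLike.congr_fun h1 p
      rw [map_mul, Equiv.Perm.mul_apply, hfix h hh, hyp, threeCycle_apply_left hpa hpb] at this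
      exact absurd this.symm hpa
    · have := DFunLike.congr_fun h1 p
      rw [map_mul, Equiv.Perm.mul_apply, hfix h hh, map_inv, hyb] at this
      exact absurd this.symm hpb
    · have := DFunLike.congr_fun h1 p
      rw [map_mul, map_mul, Equiv.Perm.mul_apply, Equiv.Perm.mul_apply, hfix h hh, map_inv, hyb,
        hπ i (Finset.mem_insert_of_mem hi), threeCycle_apply_right] at this
      exact absurd hi (by rw [show i = p from this]; exact hp)

/-- Commuting involutions that are separated by subgroups are independent. -/
theorem eq_one_of_mem_closure_involutions {ι : Type*} [DecidableEq ι] (s : ι → G)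
    (H : ι → Subgroup G) (F : Finset ι) (hs : ∀ i ∈ F, s i * s i = 1)
    (hc : ∀ i ∈ F, ∀ j ∈ F, s i * s j = s j * s i)
    (hne : ∀ i ∈ F, ∀ j ∈ F, j ≠ i → s j ∈ H i) (heq : ∀ i ∈ F, s i ∉ H i) :
    ∀ w ∈ Subgroup.closure (s '' F), (∀ i ∈ F, w ∈ H i) → w = 1 := by
  induction F using Finset.induction_on with
  | empty => intro w hw _; simpa using hw
  | insert p F hp ih =>
    have hpF := Finset.mem_insert_self p F
    have hF : ∀ {i}, i ∈ F → i ∈ insert p F := fun hi => Finset.mem_insert_of_mem hi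
    have ih' := ih (fun i hi => hs i (hF hi)) (fun i hi j hj => hc i (hF hi) j (hF hj))
      (fun i hi j hj => hne i (hF hi) j (hF hj)) (fun i hi => heq i (hF hi))
    set K := Subgroup.closure (s '' F) with hK
    have step : ∀ g ∈ s '' (insert p F : Finset ι), ∀ w, (w ∈ K ∨ ∃ k ∈ K, w = s p * k) →
        (g * w ∈ K ∨ ∃ k ∈ K, g * w = s p * k) := by
      rintro g ⟨i, hi, rfl⟩ w hw
      rcases Finset.mem_insert.1 hi with rfl | hi
      · rcases hw with hw | ⟨k, hk, rfl⟩
        · exact Or.inr ⟨w, hw, rfl⟩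
        · exact Or.inl (by rwa [← mul_assoc, hs i hpF, one_mul])
      · have hi' : s i ∈ K := Subgroup.subset_closure ⟨i, hi, rfl⟩
        rcases hw with hw | ⟨k, hk, rfl⟩
        · exact Or.inl (K.mul_mem hi' hw)
        · exact Or.inr ⟨s i * k, K.mul_mem hi' hk, by
            rw [← mul_assoc, hc i (hF hi) p hpF, mul_assoc]⟩
    intro w hw hwH
    have key : w ∈ K ∨ ∃ k ∈ K, w = s p * k := by
      clear hwH
      induction hw using Subgroup.closure_induction_left with
      | one => exact Or.inl K.one_mem
      | mul_left g hg w _ hw => exact step g hg w hw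
      | inv_mul_cancel g hg w _ hw =>
        have : g⁻¹ = g := by
          obtain ⟨i, hi, rfl⟩ := hg
          exact inv_eq_of_mul_eq_one_left (hs i hi)
        rw [this]
        exact step g hg w hw
    rcases key with hw | ⟨k, hk, rfl⟩
    · exact ih' w hw fun i hi => hwH i (hF hi)
    -- The subgroup `H p` contains K but not `s p`, so it excludes the nontrivial coset.
    · have hkH : K ≤ H p := by
        rw [hK, Subgroup.closure_le]
        rintro _ ⟨j, hj, rfl⟩
        exact hne p hpF j (hF hj) (fun h => hp (h ▸ hj))
      exact absurd ((Subgroup.mul_mem_cancel_right _ (hkH hk)).1 (hwH p hpF)) (heq p hpF)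

theorem mk_mem_closure_image {ι : Type*} (Z : Subgroup G) [Z.Normal] (x : ι → G) (F : Set ι)
    {w : G} (hw : w ∈ Subgroup.closure (x '' F)) :
    (w : G ⧸ Z) ∈ Subgroup.closure ((fun i => (x i : G ⧸ Z)) '' F) := by
  have := Subgroup.mem_map_of_mem (QuotientGroup.mk' Z) hw
  rw [MonoidHom.map_closure, ← Set.image_comp] at this
  exact this

/-- The version of `eq_one_of_mem_closure_threeCycles` with relations modulo a normal subgroup. -/
theorem mem_of_mem_closure_threeCycles {α : Type*} [DecidableEq α] (π : G →* Equiv.Perm α)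
    (Z : Subgroup G) [Z.Normal] (hZ : Z ≤ π.ker)
    {a b : α} (x : α → G) (F : Finset α) (ha : a ∉ F) (hb : b ∉ F)
    (h3 : ∀ i ∈ F, x i ^ 3 ∈ Z) (h2 : ∀ i ∈ F, ∀ j ∈ F, i ≠ j → (x i * x j) ^ 2 ∈ Z)
    (hπ : ∀ i ∈ F, π (x i) = threeCycle i a b) {w : G}
    (hw : w ∈ Subgroup.closure (x '' F)) (h1 : π w = 1) : w ∈ Z := by
  rw [← QuotientGroup.eq_one_iff]
  refine eq_one_of_mem_closure_threeCycles (QuotientGroup.lift Z π hZ) (fun i => (x i : G ⧸ Z))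
    F ha hb (fun i hi => ?_) (fun i hi j hj hij => ?_) (fun i hi => ?_) _
    (mk_mem_closure_image Z x F hw) ?_
  · exact (QuotientGroup.eq_one_iff (x i ^ 3)).2 (h3 i hi)
  · exact (QuotientGroup.eq_one_iff ((x i * x j) ^ 2)).2 (h2 i hi j hj hij)
  · exact hπ i hi
  · exact h1

/-- The version of `eq_one_of_mem_closure_involutions` with relations modulo a normal subgroup. -/
theorem mem_of_mem_closure_involutions {ι : Type*} [DecidableEq ι] (Z : Subgroup G) [Z.Normal]
    (s : ι → G) (H : ι → Subgroup G) (F : Finset ι) (hZ : ∀ i ∈ F, Z ≤ H i)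
    (hs : ∀ i ∈ F, s i * s i ∈ Z) (hc : ∀ i ∈ F, ∀ j ∈ F, (s i * s j)⁻¹ * (s j * s i) ∈ Z)
    (hne : ∀ i ∈ F, ∀ j ∈ F, j ≠ i → s j ∈ H i) (heq : ∀ i ∈ F, s i ∉ H i) {w : G}
    (hw : w ∈ Subgroup.closure (s '' F)) (h1 : ∀ i ∈ F, w ∈ H i) : w ∈ Z := by
  rw [← QuotientGroup.eq_one_iff]
  refine eq_one_of_mem_closure_involutions (fun i => (s i : G ⧸ Z))
    (fun i => (H i).map (QuotientGroup.mk' Z)) F (fun i hi => ?_) (fun i hi j hj => ?_)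
    (fun i hi j hj hij => ?_) (fun i hi h => ?_) _ (mk_mem_closure_image Z s F hw)
    (fun i hi => Subgroup.mem_map_of_mem _ (h1 i hi))
  · exact (QuotientGroup.eq_one_iff (s i * s i)).2 (hs i hi)
  · exact QuotientGroup.eq.2 (hc i hi j hj)
  · exact Subgroup.mem_map_of_mem _ (hne i hi j hj hij)
  · refine heq i hi ?_
    have : s i ∈ ((H i).map (QuotientGroup.mk' Z)).comap (QuotientGroup.mk' Z) := h
    rwa [Subgroup.comap_map_eq, QuotientGroup.ker_mk', sup_eq_left.2 (hZ i hi)] at this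

end Words

/-! ### Lifts to central extensions -/

section Lifts

variable {Y G : Type*} [Group Y] [Group G] {q : Y →* G}

theorem IsCentralExtension.comm (hq : IsCentralExtension q) {k : Y} (hk : q k = 1) (y : Y) :
    y * k = k * y :=
  Subgroup.mem_center_iff.1 (hq.2 hk) y

theorem IsCentralExtension.exists_eq_mul (hq : IsCentralExtension q) {y y' : Y}
    (h : q y = q y') : ∃ k, q k = 1 ∧ y = k * y' ∧ ∀ u, u * k = k * u :=
  ⟨y * y'⁻¹, by simp [h], by simp, hq.comm (by simp [h])⟩

/-- Central factors cancel in a commutator, so commutators of lifts are canonical. This yields the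
value of c, the uniqueness of lifts from perfect groups, and surjectivity in
`exists_lift_towerProj`. -/
theorem IsCentralExtension.commutator_eq (hq : IsCentralExtension q) {a b a' b' : Y}
    (ha : q a = q a') (hb : q b = q b') : ⁅a, b⁆ = ⁅a', b'⁆ := by
  obtain ⟨k, -, rfl, hk⟩ := hq.exists_eq_mul ha
  obtain ⟨l, -, rfl, hl⟩ := hq.exists_eq_mul hb
  simp only [commutatorElement_def, mul_inv_rev]
  calc k * a' * (l * b') * (a'⁻¹ * k⁻¹) * (b'⁻¹ * l⁻¹)
      = k * (a' * l) * b' * a'⁻¹ * (k⁻¹ * b'⁻¹ * l⁻¹) := by group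
    _ = (k * l) * (a' * b' * a'⁻¹ * b'⁻¹) * (l * k)⁻¹ := by
        have : k⁻¹ * b'⁻¹ = b'⁻¹ * k⁻¹ := by rw [← mul_inv_rev, ← mul_inv_rev, hk]
        rw [hl, this]; group
    _ = _ := by
        rw [mul_assoc k, ← hl, ← mul_assoc, ← hk, mul_assoc _ k, hl k]; group

/-- If q u centralizes q t, then u t u⁻¹ = k t with k central. The assignment u ↦ k is a
homomorphism to an abelian group, so it is trivial on commutators. -/
theorem IsCentralExtension.mul_comm_of_mem_commutator (hq : IsCentralExtension q) {y t : Y}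
    (h : q y ∈ ⁅Subgroup.centralizer {q t}, Subgroup.centralizer {q t}⁆) : y * t = t * y := by
  set D := (Subgroup.centralizer {q t}).comap q with hD
  have hle : ⁅D, D⁆ ≤ Subgroup.centralizer {t} := by
    rw [Subgroup.commutator_le]
    intro u hu v hv
    have aux : ∀ u ∈ D, ∃ k, (∀ y, y * k = k * y) ∧ u * t * u⁻¹ = k * t := by
      intro u hu
      have : q (u * t * u⁻¹) = q t := by
        have := Subgroup.mem_centralizer_singleton_iff.1 (Subgroup.mem_comap.1 hu)
        rw [map_mul, map_mul, this, map_inv, mul_inv_cancel_right]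
      obtain ⟨k, -, h1, h2⟩ := hq.exists_eq_mul this
      exact ⟨k, h2, h1⟩
    obtain ⟨k, hk, hu⟩ := aux u hu
    obtain ⟨l, hl, hv⟩ := aux v hv
    have hu' : u * t = k * t * u := by rw [← hu]; group
    have hv' : v * t = l * t * v := by rw [← hv]; group
    have e1 : (u * v) * t = (k * l) * t * (u * v) := by
      calc (u * v) * t = u * (v * t) := by group
        _ = (u * l) * t * v := by rw [hv']; group
        _ = l * (u * t) * v := by rw [hl]; group
        _ = _ := by rw [hu', ← hk l]; group
    have e2 : (v * u) * t = (k * l) * t * (v * u) := by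
      calc (v * u) * t = v * (u * t) := by group
        _ = (v * k) * t * u := by rw [hu']; group
        _ = k * (v * t) * u := by rw [hk]; group
        _ = _ := by rw [hv']; group
    rw [Subgroup.mem_centralizer_singleton_iff]
    have e3 : ⁅u, v⁆ = (u * v) * (v * u)⁻¹ := by rw [commutatorElement_def]; group
    have e4 : (v * u)⁻¹ * t = (k * l)⁻¹ * t * (v * u)⁻¹ := by
      have : (v * u)⁻¹ * (k * l)⁻¹ * (v * u * t) = (v * u)⁻¹ * t * (v * u) := by
        rw [e2]; group
      have hkl : (k * l)⁻¹ * (v * u) = (v * u) * (k * l)⁻¹ := by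
        have : (v * u) * (k * l) = (k * l) * (v * u) := by
          rw [← mul_assoc, hk, mul_assoc, hl, mul_assoc]
        rw [inv_mul_eq_iff_eq_mul, ← mul_assoc, ← this, mul_inv_cancel_right]
      have h5 : (v * u)⁻¹ * t * (v * u) = (k * l)⁻¹ * t := by
        rw [← this, mul_assoc (v * u)⁻¹, ← mul_assoc (k * l)⁻¹, hkl]; group
      rw [← h5]; group
    have hkl : (u * v) * (k * l)⁻¹ = (k * l)⁻¹ * (u * v) := by
      have : (u * v) * (k * l) = (k * l) * (u * v) := by
        rw [← mul_assoc, hk, mul_assoc, hl, mul_assoc]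
      rw [eq_inv_mul_iff_mul_eq, ← mul_assoc, ← this, mul_inv_cancel_right]
    rw [e3, mul_assoc, e4, ← mul_assoc, ← mul_assoc, hkl, mul_assoc (k * l)⁻¹, e1]
    group
  have hmap : D.map q = Subgroup.centralizer {q t} :=
    Subgroup.map_comap_eq_self_of_surjective hq.1 _
  -- The element y differs by a central factor from an element of ⁅D, D⁆, and central factors do not
  -- affect commuting with t.
  rw [← hmap, ← Subgroup.map_commutator] at h
  obtain ⟨y', hy', hyy⟩ := h
  obtain ⟨k, -, rfl, hk⟩ := hq.exists_eq_mul hyy.symm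
  have := Subgroup.mem_centralizer_singleton_iff.1 (hle hy')
  rw [mul_assoc, this, ← mul_assoc, ← mul_assoc, hk]

/-- Equivariant lifts to a central extension of a transitive family of elements, when the
stabilizers of its members consist of commutators of elements that centralize them. -/
theorem IsCentralExtension.exists_equivariant_lift (hq : IsCentralExtension q) {A I : Type*}
    [Group A] [MulAction A I] [MulAction.IsPretransitive A I] (ρ : A →* G) (v : I → G)
    (hv : ∀ g i, v (g • i) = ρ g * v i * (ρ g)⁻¹)
    (hst : ∀ i g, g • i = i →
      ρ g ∈ ⁅Subgroup.centralizer {v i}, Subgroup.centralizer {v i}⁆) :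
    ∃ s : I → Y, (∀ i, q (s i) = v i) ∧
      ∀ y g i, q y = ρ g → s (g • i) = y * s i * y⁻¹ := by
  rcases isEmpty_or_nonempty I with hI | ⟨⟨o⟩⟩
  · exact ⟨fun i => hI.elim i, fun i => hI.elim i, fun _ _ i => hI.elim i⟩
  -- One lift t at the base point o is transported by lifts η of chosen group elements that carry o
  -- to i. Two transports to the same point differ by an element over the stabilizer of o, which
  -- commutes with t.
  obtain ⟨t, ht⟩ := hq.1 (v o)
  choose γ hγ using fun i => MulAction.exists_smul_eq A o i
  choose η hη using fun i => hq.1 (ρ (γ i))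
  refine ⟨fun i => η i * t * (η i)⁻¹, fun i => ?_, fun y g i hy => ?_⟩
  · rw [map_mul, map_mul, map_inv, hη, ht, ← hv, hγ]
  · have hstab : ((γ (g • i))⁻¹ * g * γ i) • o = o := by
      rw [mul_smul, mul_smul, hγ, inv_smul_eq_iff, hγ]
    have hcomm := hq.mul_comm_of_mem_commutator (y := (η (g • i))⁻¹ * y * η i) (t := t) (by
      rw [ht]
      convert hst o _ hstab using 1
      simp only [map_mul, map_inv, hη, hy])
    have h1 : y * η i * t = η (g • i) * t * (η (g • i))⁻¹ * y * η i := by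
      calc y * η i * t = η (g • i) * ((η (g • i))⁻¹ * y * η i * t) := by group
        _ = _ := by rw [hcomm]; group
    calc η (g • i) * t * (η (g • i))⁻¹
        = (η (g • i) * t * (η (g • i))⁻¹ * y * η i) * (η i)⁻¹ * y⁻¹ := by group
      _ = _ := by rw [← h1]; group

end Lifts

/-! ### Even permutations -/

section EvenPermutations

variable {n : ℕ}

/-- The product of the transpositions `(a b)` and `(c d)`; the identity if one of them is not a
transposition. -/
def doubleSwap (a b c d : Fin n) : alternatingGroup (Fin n) :=
  if h : a ≠ b ∧ c ≠ d then
    ⟨Equiv.swap a b * Equiv.swap c d, by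
      simp [Equiv.Perm.mem_alternatingGroup, Equiv.Perm.sign_swap h.1, Equiv.Perm.sign_swap h.2]⟩
  else 1

theorem coe_doubleSwap {a b c d : Fin n} (h1 : a ≠ b) (h2 : c ≠ d) :
    (doubleSwap a b c d : Equiv.Perm (Fin n)) = Equiv.swap a b * Equiv.swap c d := by
  rw [doubleSwap, dif_pos ⟨h1, h2⟩]

theorem conj_doubleSwap (g : alternatingGroup (Fin n)) (a b c d : Fin n) :
    g * doubleSwap a b c d * g⁻¹ = doubleSwap (g • a) (g • b) (g • c) (g • d) := by
  by_cases h : a ≠ b ∧ c ≠ d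
  · have h' : g • a ≠ g • b ∧ g • c ≠ g • d := by simpa using h
    apply Subtype.ext
    rw [coe_doubleSwap h'.1 h'.2, Subgroup.coe_mul, Subgroup.coe_mul, coe_doubleSwap h.1 h.2,
      Subgroup.coe_inv]
    have aux : ∀ x y : Fin n, Equiv.swap (g • x) (g • y)
        = (g : Equiv.Perm (Fin n)) * Equiv.swap x y * (g : Equiv.Perm (Fin n))⁻¹ := fun x y => by
      rw [← Equiv.swap_apply_apply]; rfl
    rw [aux, aux]; group
  · have h' : ¬ (g • a ≠ g • b ∧ g • c ≠ g • d) := by simpa using h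
    rw [doubleSwap, doubleSwap, dif_neg h, dif_neg h']; group

/-- When the two transpositions share a point their product is a 3-cycle, so `doubleSwap a b b c`
serves as the 3-cycle inside the alternating group. -/
theorem coe_doubleSwap_threeCycle {a b c : Fin n} (h1 : a ≠ b) (h2 : b ≠ c) :
    (doubleSwap a b b c : Equiv.Perm (Fin n)) = threeCycle a b c :=
  coe_doubleSwap h1 h2

/-- The product of the 3-cycles `(i a b)` and `(j a b)` is a double transposition. -/
theorem threeCycle_mul_threeCycle {a b i j : Fin n} (hab : a ≠ b) (hia : i ≠ a) (hib : i ≠ b)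
    (hja : j ≠ a) (hjb : j ≠ b) (hij : i ≠ j) :
    doubleSwap i a a b * doubleSwap j a a b = doubleSwap i a j b := by
  apply Subtype.ext
  rw [Subgroup.coe_mul, coe_doubleSwap hia hab, coe_doubleSwap hja hab, coe_doubleSwap hia hjb]
  ext x
  simp only [Equiv.Perm.mul_apply, Equiv.swap_apply_def]
  grind

theorem doubleSwap_mul_self {a b c d : Fin n} (h1 : a ≠ b) (h2 : c ≠ d) (hac : a ≠ c)
    (had : a ≠ d) (hbc : b ≠ c) (hbd : b ≠ d) :
    doubleSwap a b c d * doubleSwap a b c d = 1 := by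
  apply Subtype.ext
  have h := Equiv.swap_apply_apply (Equiv.swap a b) c d
  rw [Equiv.swap_apply_of_ne_of_ne hac.symm hbc.symm,
    Equiv.swap_apply_of_ne_of_ne had.symm hbd.symm, eq_mul_inv_iff_mul_eq] at h
  rw [Subgroup.coe_mul, coe_doubleSwap h1 h2, mul_assoc, ← mul_assoc (Equiv.swap c d), h,
    ← mul_assoc, ← mul_assoc, Equiv.swap_mul_self, one_mul, Equiv.swap_mul_self, Subgroup.coe_one]

/-- The alternating group acts transitively on `k`-tuples of distinct points for `k + 2 ≤ n`. -/
theorem isPretransitive_embedding {k : ℕ} (h : k + 2 ≤ n) :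
    MulAction.IsPretransitive (alternatingGroup (Fin n)) (Fin k ↪ Fin n) := by
  have := alternatingGroup.isMultiplyPretransitive (Fin n)
  exact MulAction.isMultiplyPretransitive_of_le (n := Nat.card (Fin n) - 2) (by simp; omega)
    (Nat.sub_le _ _)

theorem exists_notMem_of_card {s : Finset (Fin n)} (hs : s.card < n) : ∃ i, i ∉ s := by
  by_contra! h
  have := Finset.card_le_card (fun x _ => h x : (Finset.univ : Finset (Fin n)) ⊆ s)
  simp at this
  omega

/-- The embedding of `Fin 2` with two distinct values. -/
def pairEmb {i j : Fin n} (h : i ≠ j) : Fin 2 ↪ Fin n :=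
  ⟨![i, j], by
    intro x y
    fin_cases x <;> fin_cases y <;> simp [h, h.symm]⟩

/-- The embedding of `Fin 3` with three distinct values. -/
def tripleEmb {i j k : Fin n} (h : i ≠ j ∧ i ≠ k ∧ j ≠ k) : Fin 3 ↪ Fin n :=
  ⟨![i, j, k], by
    obtain ⟨h1, h2, h3⟩ := h
    intro x y
    fin_cases x <;> fin_cases y <;> simp [h1, h2, h3, h1.symm, h2.symm, h3.symm]⟩

/-- The embedding of `Fin 4` with four distinct values. -/
def quadEmb {i j k l : Fin n} (h : i ≠ j ∧ i ≠ k ∧ i ≠ l ∧ j ≠ k ∧ j ≠ l ∧ k ≠ l) :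
    Fin 4 ↪ Fin n :=
  ⟨![i, j, k, l], by
    obtain ⟨h1, h2, h3, h4, h5, h6⟩ := h
    intro x y
    fin_cases x <;> fin_cases y <;>
      simp [h1, h2, h3, h4, h5, h6, h1.symm, h2.symm, h3.symm, h4.symm, h5.symm, h6.symm]⟩

theorem exists_alternating_pair (hn : 8 ≤ n) {i j i' j' : Fin n} (h : i ≠ j) (h' : i' ≠ j') :
    ∃ g : alternatingGroup (Fin n), g • i = i' ∧ g • j = j' := by
  have := isPretransitive_embedding (n := n) (k := 2) (by omega)
  obtain ⟨g, hg⟩ := MulAction.exists_smul_eq (alternatingGroup (Fin n)) (pairEmb h) (pairEmb h')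
  exact ⟨g, DFunLike.congr_fun hg 0, DFunLike.congr_fun hg 1⟩

theorem exists_alternating_triple (hn : 8 ≤ n) {i j k i' j' k' : Fin n}
    (h : i ≠ j ∧ i ≠ k ∧ j ≠ k) (h' : i' ≠ j' ∧ i' ≠ k' ∧ j' ≠ k') :
    ∃ g : alternatingGroup (Fin n), g • i = i' ∧ g • j = j' ∧ g • k = k' := by
  have := isPretransitive_embedding (n := n) (k := 3) (by omega)
  obtain ⟨g, hg⟩ := MulAction.exists_smul_eq (alternatingGroup (Fin n)) (tripleEmb h) (tripleEmb h')
  exact ⟨g, DFunLike.congr_fun hg 0, DFunLike.congr_fun hg 1, DFunLike.congr_fun hg 2⟩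

theorem exists_alternating_quad (hn : 8 ≤ n) {i j k l i' j' k' l' : Fin n}
    (h : i ≠ j ∧ i ≠ k ∧ i ≠ l ∧ j ≠ k ∧ j ≠ l ∧ k ≠ l)
    (h' : i' ≠ j' ∧ i' ≠ k' ∧ i' ≠ l' ∧ j' ≠ k' ∧ j' ≠ l' ∧ k' ≠ l') :
    ∃ g : alternatingGroup (Fin n), g • i = i' ∧ g • j = j' ∧ g • k = k' ∧ g • l = l' := by
  have := isPretransitive_embedding (n := n) (k := 4) (by omega)
  obtain ⟨g, hg⟩ := MulAction.exists_smul_eq (alternatingGroup (Fin n)) (quadEmb h) (quadEmb h')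
  exact ⟨g, DFunLike.congr_fun hg 0, DFunLike.congr_fun hg 1, DFunLike.congr_fun hg 2,
    DFunLike.congr_fun hg 3⟩

/-- The pointwise stabilizer of at most `n - 5` points is perfect. -/
theorem mem_commutator_fixing {s : Finset (Fin n)} (hs : s.card + 5 ≤ n)
    {g : alternatingGroup (Fin n)} (hg : ∀ i ∈ s, g • i = i) (H : Subgroup (alternatingGroup (Fin n)))
    (hH : ∀ g : alternatingGroup (Fin n), (∀ i ∈ s, g • i = i) → g ∈ H) : g ∈ ⁅H, H⁆ := by
  have hle : (alternatingGroup.ofSubtype sᶜ).range ≤ H := by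
    intro f hf
    rw [alternatingGroup.mem_range_ofSubtype_iff] at hf
    refine hH f fun i hi => ?_
    by_contra h
    exact Finset.mem_compl.1 (hf (Equiv.Perm.mem_support.2 h)) hi
  have hmem : g ∈ (alternatingGroup.ofSubtype sᶜ).range := by
    rw [alternatingGroup.mem_range_ofSubtype_iff]
    intro i hi
    rw [Finset.mem_compl]
    intro his
    exact (Equiv.Perm.mem_support.1 hi) (hg i his)
  -- The stabilizer is the alternating group on the complement of s, which is perfect from five
  -- points on.
  have h5 : 5 ≤ Nat.card (sᶜ : Finset (Fin n)) := by
    rw [Nat.card_eq_fintype_card, Fintype.card_coe, Finset.card_compl, Fintype.card_fin]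
    omega
  rw [MonoidHom.range_eq_map, ← commutator_alternatingGroup_eq_top h5, commutator_def,
    Subgroup.map_commutator, ← MonoidHom.range_eq_map] at hmem
  exact Subgroup.commutator_mono hle hle hmem

theorem alternating_isPerfect (hn : 8 ≤ n) : commutator (alternatingGroup (Fin n)) = ⊤ :=
  commutator_alternatingGroup_eq_top (by simp; omega)

/-- The 3-cycles `(i a b)` for fixed `a` and `b` generate the alternating group. -/
theorem closure_threeCycle_eq_top {a b : Fin n} (hab : a ≠ b) :
    Subgroup.closure ((fun i => doubleSwap i a a b) '' {i | i ≠ a ∧ i ≠ b}) = ⊤ := by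
  set H := Subgroup.closure ((fun i => doubleSwap i a a b) '' {i | i ≠ a ∧ i ≠ b}) with hH
  -- The argument runs in the symmetric group, with t = (a b): K ∪ Kt is closed under left
  -- multiplication by transpositions, hence everything, and the sign singles out K.
  set K : Subgroup (Equiv.Perm (Fin n)) := H.map (alternatingGroup (Fin n)).subtype with hK
  have hgen : ∀ i, i ≠ a → i ≠ b → Equiv.swap i a * Equiv.swap a b ∈ K := fun i h1 h2 =>
    ⟨doubleSwap i a a b, Subgroup.subset_closure ⟨i, ⟨h1, h2⟩, rfl⟩, coe_doubleSwap h1 hab⟩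
  set t := Equiv.swap a b with ht
  have htt : t * t = 1 := Equiv.swap_mul_self a b
  have hti : t⁻¹ = t := Equiv.swap_inv a b
  -- Conjugation by t inverts each generator (i a)t, because t(i a)tt = t(i a) is its inverse.
  have hconj : ∀ k ∈ K, t * k * t ∈ K := by
    intro k hk
    obtain ⟨k, hk, rfl⟩ := hk
    induction hk using Subgroup.closure_induction with
    | mem _ h =>
      obtain ⟨i, ⟨h1, h2⟩, rfl⟩ := h
      have := K.inv_mem (hgen i h1 h2)
      rw [mul_inv_rev, hti, Equiv.swap_inv] at this
      simp only [Subgroup.coe_subtype, coe_doubleSwap h1 hab]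
      rwa [← ht, mul_assoc, mul_assoc, htt, mul_one]
    | one => simp [htt]
    | mul u v _ _ hu hv =>
      have : t * (alternatingGroup (Fin n)).subtype (u * v) * t
          = (t * (alternatingGroup (Fin n)).subtype u * t)
            * (t * (alternatingGroup (Fin n)).subtype v * t) := by
        rw [map_mul]
        simp only [mul_assoc]
        rw [← mul_assoc t t, htt, one_mul]
      rw [this]; exact K.mul_mem hu hv
    | inv u _ hu =>
      have : t * (alternatingGroup (Fin n)).subtype u⁻¹ * t
          = (t * (alternatingGroup (Fin n)).subtype u * t)⁻¹ := by
        rw [mul_inv_rev, mul_inv_rev, hti, map_inv, mul_assoc]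
      rw [this]; exact K.inv_mem hu
  have hstar : ∀ x, x ≠ a → Equiv.swap x a * t ∈ K := by
    intro x hx
    by_cases hxb : x = b
    · rw [hxb, Equiv.swap_comm b a, ← ht, htt]; exact K.one_mem
    · exact hgen x hx hxb
  have hmul : ∀ u v, u * t ∈ K → v * t ∈ K → u * v ∈ K := by
    intro u v hu hv
    have := K.mul_mem hu (hconj _ hv)
    rwa [show u * t * (t * (v * t) * t) = u * (t * t) * v * (t * t) by group, htt, mul_one,
      mul_one] at this
  have hmul' : ∀ u v, u ∈ K → v * t ∈ K → u * v * t ∈ K := fun u v hu hv => by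
    rw [mul_assoc]; exact K.mul_mem hu hv
  have hswap : ∀ x y, x ≠ y → Equiv.swap x y * t ∈ K := by
    intro x y hxy
    by_cases hxa : x = a
    · subst hxa
      rw [Equiv.swap_comm]; exact hstar y hxy.symm
    by_cases hya : y = a
    · subst hya
      exact hstar x hxa
    · have h := Equiv.swap_mul_swap_mul_swap hxa hxy
      rw [Equiv.swap_comm a y] at h
      rw [Equiv.swap_comm x y, ← h]
      exact hmul' _ _ (hmul _ _ (hstar y hya) (hstar x hxa)) (hstar y hya)
  have hall : ∀ σ : Equiv.Perm (Fin n), σ ∈ K ∨ σ * t ∈ K := by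
    intro σ
    induction σ using Equiv.Perm.swap_induction_on with
    | one => exact Or.inl K.one_mem
    | swap_mul f x y hxy hf =>
      have h := hswap x y hxy
      rcases hf with hf | hf
      · right
        have := K.mul_mem h (hconj _ hf)
        rwa [show Equiv.swap x y * t * (t * f * t) = Equiv.swap x y * (t * t) * f * t by group, htt,
          mul_one] at this
      · exact Or.inl (hmul _ _ h hf)
  rw [eq_top_iff]
  intro g _
  rcases hall g with ⟨k, hk, h⟩ | ⟨k, hk, h⟩
  · rwa [← Subtype.ext h]
  · have h1 : Equiv.Perm.sign (k : Equiv.Perm (Fin n)) = 1 := k.2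
    have h2 : Equiv.Perm.sign (g : Equiv.Perm (Fin n)) = 1 := g.2
    have h' : (k : Equiv.Perm (Fin n)) = g * t := h
    rw [h', map_mul, h2, Equiv.Perm.sign_swap hab] at h1
    exact absurd h1 (by decide)

end EvenPermutations

/-! ### Canonical lifts to central extensions of `Aₙ ⋉ (𝔽₂ⁿ)ᵉᵛ` -/

section CanonicalLifts

variable {n : ℕ}

/-- The even vector `eᵢ + eⱼ`. -/
def pairVec (i j : Fin n) : evenBinary n :=
  ⟨Multiplicative.ofAdd (Pi.single i 1 + Pi.single j 1), by
    rw [evenBinary, MonoidHom.mem_ker]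
    apply Multiplicative.toAdd.injective
    change ∑ k, ((Pi.single i 1 : Fin n → ZMod 2) k + (Pi.single j 1 : Fin n → ZMod 2) k) = 0
    rw [Finset.sum_add_distrib, Finset.sum_pi_single', Finset.sum_pi_single']
    simpa using CharTwo.add_self_eq_zero (1 : ZMod 2)⟩

theorem coe_pairVec (i j : Fin n) : ((pairVec i j : evenBinary n) : BinaryWords n).toAdd
    = Pi.single i 1 + Pi.single j 1 := rfl

theorem altBinary_pairVec (g : alternatingGroup (Fin n)) (i j : Fin n) :
    altBinary n g (pairVec i j) = pairVec (g • i) (g • j) := by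
  have aux : ∀ (a k : Fin n), (Pi.single a 1 : Fin n → ZMod 2) ((g : Equiv.Perm (Fin n))⁻¹ k)
      = (Pi.single (g • a) 1 : Fin n → ZMod 2) k := fun a k => by
    simp only [Pi.single_apply, Equiv.Perm.inv_eq_iff_eq]
    rfl
  apply Subtype.ext
  apply Multiplicative.toAdd.injective
  funext k
  exact congrArg₂ (· + ·) (aux i k) (aux j k)

theorem inr_mul_pairVec (g : alternatingGroup (Fin n)) (i j : Fin n) :
    (SemidirectProduct.inl (pairVec (g • i) (g • j)) : EvenSignedAlt n)
      = SemidirectProduct.inr g * SemidirectProduct.inl (pairVec i j)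
        * (SemidirectProduct.inr g)⁻¹ := by
  rw [← altBinary_pairVec, SemidirectProduct.inl_aut]; simp

variable {Y : Type*} [Group Y] {q : Y →* EvenSignedAlt n}

/-- Injective k-tuples form a transitive Aₙ-set. The stabilizer of a tuple fixes k points, so it
consists of commutators of its own elements, and by equivariance it centralizes the value of v. This
is the input of `exists_equivariant_lift`. -/
theorem exists_equivariant_lift_embedding (hq : IsCentralExtension q) {k : ℕ} (hk : k + 5 ≤ n)
    (v : (Fin k ↪ Fin n) → EvenSignedAlt n)
    (hv : ∀ (g : alternatingGroup (Fin n)) i,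
      v (g • i) = SemidirectProduct.inr g * v i * (SemidirectProduct.inr g)⁻¹) :
    ∃ s : (Fin k ↪ Fin n) → Y, (∀ i, q (s i) = v i) ∧
      ∀ y (g : alternatingGroup (Fin n)) i, q y = SemidirectProduct.inr g →
        s (g • i) = y * s i * y⁻¹ := by
  have h := isPretransitive_embedding (n := n) (k := k) (by omega)
  refine @IsCentralExtension.exists_equivariant_lift _ _ _ _ _ hq (alternatingGroup (Fin n)) (Fin k ↪ Fin n)
    _ _ h SemidirectProduct.inr v hv fun i g hg => ?_
  have key := mem_commutator_fixing (s := Finset.univ.map i) (by simpa using hk) (g := g)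
    (fun x hx => by
      obtain ⟨y, -, rfl⟩ := Finset.mem_map.1 hx
      exact DFunLike.congr_fun hg y)
    ((Subgroup.centralizer {v i}).comap SemidirectProduct.inr) (fun h hh => by
      have hi : h • i = i := by
        ext1 x
        exact hh _ (Finset.mem_map_of_mem i (Finset.mem_univ x))
      rw [Subgroup.mem_comap, Subgroup.mem_centralizer_singleton_iff]
      have := hv h i
      rwa [hi, eq_mul_inv_iff_mul_eq, eq_comm] at this)
  have := Subgroup.mem_map_of_mem (SemidirectProduct.inr :
    alternatingGroup (Fin n) →* EvenSignedAlt n) key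
  rw [Subgroup.map_commutator] at this
  exact Subgroup.commutator_mono (Subgroup.map_comap_le _ _) (Subgroup.map_comap_le _ _) this

/-- A family of elements of `Y` indexed by triples is equivariant for the lifts of even
permutations. -/
def EquivariantTriples (q : Y →* EvenSignedAlt n) (T : Fin n → Fin n → Fin n → Y) : Prop :=
  ∀ (y : Y) (g : alternatingGroup (Fin n)) (a b c : Fin n), q y = SemidirectProduct.inr g →
    T (g • a) (g • b) (g • c) = y * T a b c * y⁻¹

/-- A family of elements of `Y` indexed by pairs is equivariant for the lifts of even
permutations. -/
def EquivariantPairs (q : Y →* EvenSignedAlt n) (S : Fin n → Fin n → Y) : Prop :=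
  ∀ (y : Y) (g : alternatingGroup (Fin n)) (a b : Fin n), q y = SemidirectProduct.inr g →
    S (g • a) (g • b) = y * S a b * y⁻¹

theorem conj_eq_self_of_central (hq : IsCentralExtension q) {y u : Y} (hu : q u = 1) :
    y * u * y⁻¹ = u := by
  rw [hq.comm hu, mul_inv_cancel_right]

theorem conj_mul_central (hq : IsCentralExtension q) {y t u : Y} (hu : q u = 1) :
    y * t * y⁻¹ * u = y * (t * u) * y⁻¹ := by
  rw [← conj_mul, conj_eq_self_of_central hq hu]

/-- Aₙ is transitive on triples of distinct points and conjugation fixes central elements. A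
relation between equivariant lifts that holds in the base thus has one central defect, the same for
all indices. -/
theorem EquivariantTriples.const (hn : 8 ≤ n) (hq : IsCentralExtension q)
    {u : Fin n → Fin n → Fin n → Y} (hu : EquivariantTriples q u)
    (h1 : ∀ a b c, a ≠ b ∧ a ≠ c ∧ b ≠ c → q (u a b c) = 1) :
    ∃ k, q k = 1 ∧ ∀ a b c, a ≠ b ∧ a ≠ c ∧ b ≠ c → u a b c = k := by
  have h0 : (⟨0, by omega⟩ : Fin n) ≠ ⟨1, by omega⟩ ∧ (⟨0, by omega⟩ : Fin n) ≠ ⟨2, by omega⟩ ∧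
      (⟨1, by omega⟩ : Fin n) ≠ ⟨2, by omega⟩ := by simp
  refine ⟨_, h1 _ _ _ h0, fun a b c h => ?_⟩
  obtain ⟨g, rfl, rfl, rfl⟩ := exists_alternating_triple hn h0 h
  obtain ⟨y, hy⟩ := hq.1 (SemidirectProduct.inr g)
  rw [hu y g _ _ _ hy, conj_eq_self_of_central hq (h1 _ _ _ h0)]

theorem EquivariantPairs.const (hn : 8 ≤ n) (hq : IsCentralExtension q)
    {u : Fin n → Fin n → Y} (hu : EquivariantPairs q u)
    (h1 : ∀ a b, a ≠ b → q (u a b) = 1) :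
    ∃ k, q k = 1 ∧ ∀ a b, a ≠ b → u a b = k := by
  have h0 : (⟨0, by omega⟩ : Fin n) ≠ ⟨1, by omega⟩ := by simp
  refine ⟨_, h1 _ _ h0, fun a b h => ?_⟩
  obtain ⟨g, rfl, rfl⟩ := exists_alternating_pair hn h0 h
  obtain ⟨y, hy⟩ := hq.1 (SemidirectProduct.inr g)
  rw [hu y g _ _ hy, conj_eq_self_of_central hq (h1 _ _ h0)]

/-- Equivariant lifts of order three of the 3-cycles. -/
theorem exists_threeCycle_lifts (hn : 8 ≤ n) (hq : IsCentralExtension q) :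
    ∃ T : Fin n → Fin n → Fin n → Y, EquivariantTriples q T ∧
      (∀ a b c, a ≠ b ∧ a ≠ c ∧ b ≠ c → q (T a b c) = SemidirectProduct.inr (doubleSwap a b b c)) ∧
      (∀ a b c, a ≠ b ∧ a ≠ c ∧ b ≠ c → T a b c ^ 3 = 1) ∧
      (∀ a b c, a ≠ b ∧ a ≠ c ∧ b ≠ c → T c b a = (T a b c)⁻¹) := by
  obtain ⟨s, hs, hs'⟩ := exists_equivariant_lift_embedding hq (k := 3) (by omega)
    (fun i => SemidirectProduct.inr (doubleSwap (i 0) (i 1) (i 1) (i 2))) (fun g i => by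
      rw [← map_inv, ← map_mul, ← map_mul, conj_doubleSwap]; rfl)
  -- The default value 1 at degenerate triples keeps the family equivariant without side conditions.
  let T₀ : Fin n → Fin n → Fin n → Y := fun a b c =>
    if h : a ≠ b ∧ a ≠ c ∧ b ≠ c then s (tripleEmb h) else 1
  have hT₀ : EquivariantTriples q T₀ := by
    intro y g a b c hy
    by_cases h : a ≠ b ∧ a ≠ c ∧ b ≠ c
    · have h' : g • a ≠ g • b ∧ g • a ≠ g • c ∧ g • b ≠ g • c := by simpa using h
      simp only [T₀, dif_pos h, dif_pos h']
      rw [← hs' y g _ hy]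
      congr 1
      ext1 x
      fin_cases x <;> rfl
    · have h' : ¬ (g • a ≠ g • b ∧ g • a ≠ g • c ∧ g • b ≠ g • c) := by simpa using h
      simp only [T₀, dif_neg h, dif_neg h']; group
  have hqT₀ : ∀ a b c, a ≠ b ∧ a ≠ c ∧ b ≠ c →
      q (T₀ a b c) = SemidirectProduct.inr (doubleSwap a b b c) := by
    intro a b c h
    simp only [T₀, dif_pos h, hs]
    rfl
  have hrev : ∀ {a b c : Fin n}, a ≠ b ∧ a ≠ c ∧ b ≠ c → c ≠ b ∧ c ≠ a ∧ b ≠ a :=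
    fun h => ⟨h.2.2.symm, h.2.1.symm, h.1.symm⟩
  have hinv : ∀ a b c : Fin n, a ≠ b ∧ a ≠ c ∧ b ≠ c →
      doubleSwap c b b a = (doubleSwap a b b c)⁻¹ := by
    intro a b c h
    apply Subtype.ext
    rw [Subgroup.coe_inv, coe_doubleSwap_threeCycle h.1 h.2.2,
      coe_doubleSwap_threeCycle h.2.2.symm h.1.symm, threeCycle_inv]
  have hcube : ∀ a b c : Fin n, a ≠ b ∧ a ≠ c ∧ b ≠ c → doubleSwap a b b c ^ 3 = 1 := by
    intro a b c h
    apply Subtype.ext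
    rw [Subgroup.coe_pow, coe_doubleSwap_threeCycle h.1 h.2.2, Subgroup.coe_one]
    ext x
    by_cases hxa : x = a
    · simp [pow_succ, hxa, threeCycle_apply_left h.1 h.2.1, threeCycle_apply_mid h.2.1 h.2.2,
        threeCycle_apply_right]
    by_cases hxb : x = b
    · simp [pow_succ, hxb, threeCycle_apply_left h.1 h.2.1, threeCycle_apply_mid h.2.1 h.2.2,
        threeCycle_apply_right]
    by_cases hxc : x = c
    · simp [pow_succ, hxc, threeCycle_apply_left h.1 h.2.1, threeCycle_apply_mid h.2.1 h.2.2,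
        threeCycle_apply_right]
    · simp [pow_succ, threeCycle_apply_of_ne hxa hxb hxc]
  obtain ⟨d, hd, hd'⟩ := EquivariantTriples.const hn hq (u := fun a b c => T₀ c b a * T₀ a b c)
    (fun y g a b c hy => by simp only [hT₀ y g _ _ _ hy]; group) (fun a b c h => by
      rw [map_mul, hqT₀ a b c h, hqT₀ c b a (hrev h), hinv a b c h, map_inv, inv_mul_cancel])
  obtain ⟨e, he, he'⟩ := EquivariantTriples.const hn hq (u := fun a b c => T₀ a b c ^ 3)
    (fun y g a b c hy => by simp only [hT₀ y g _ _ _ hy, conj_pow]) (fun a b c h => by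
      rw [map_pow, hqT₀ a b c h, ← map_pow, hcube a b c h, map_one])
  -- Cubing T₀ c b a = d (T₀ a b c)⁻¹ gives e = d³ e⁻¹.
  have hde : d ^ 3 = e ^ 2 := by
    have h : (⟨0, by omega⟩ : Fin n) ≠ ⟨1, by omega⟩ ∧ (⟨0, by omega⟩ : Fin n) ≠ ⟨2, by omega⟩ ∧
      (⟨1, by omega⟩ : Fin n) ≠ ⟨2, by omega⟩ := by simp
    have h1 := he' _ _ _ (hrev h)
    have h2 := eq_mul_inv_of_mul_eq (hd' _ _ _ h)
    have h3 := he' _ _ _ h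
    have hcom : Commute d (T₀ ⟨0, by omega⟩ ⟨1, by omega⟩ ⟨2, by omega⟩)⁻¹ :=
      (hq.comm hd _).symm
    rw [h2, hcom.mul_pow, inv_pow, h3, mul_inv_eq_iff_eq_mul] at h1
    rw [h1, pow_two]
  -- Rescaling by f = d e⁻¹ multiplies the cube by f³ and the defect d of inversion by f². Since d³
  -- = e², both e f³ and d f² equal 1, so one factor corrects both relations.
  have hf : q (d * e⁻¹) = 1 := by rw [map_mul, map_inv, hd, he]; simp
  have hcde : Commute d e := hq.comm he d
  replace hcde := hcde.inv_right
  have hf2 : d * (d * e⁻¹) ^ 2 = 1 := by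
    rw [hcde.mul_pow, ← mul_assoc, ← pow_succ', hde, inv_pow, mul_inv_cancel]
  have hf3 : e * (d * e⁻¹) ^ 3 = 1 := by
    rw [hcde.mul_pow, hde]; group
  refine ⟨fun a b c => T₀ a b c * (d * e⁻¹), fun y g a b c hy => ?_, fun a b c h => ?_,
    fun a b c h => ?_, fun a b c h => ?_⟩
  · simp only
    rw [hT₀ y g a b c hy, conj_mul_central hq hf]
  · simp only
    rw [map_mul, hf, mul_one, hqT₀ a b c h]
  · have : Commute (T₀ a b c) (d * e⁻¹) := hq.comm hf _
    rw [this.mul_pow, he' a b c h, hf3]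
  · have hdc := hd' a b c h
    simp only at hdc ⊢
    rw [eq_inv_iff_mul_eq_one, mul_assoc, ← mul_assoc (d * e⁻¹), ← hq.comm hf, mul_assoc,
      ← mul_assoc, hdc, ← pow_two, hf2]

/-- Conjugating `T a b c` by itself changes nothing, but by equivariance it rotates the indices. -/
theorem rotate_lift {T : Fin n → Fin n → Fin n → Y} (hT : EquivariantTriples q T)
    (hqT : ∀ a b c, a ≠ b ∧ a ≠ c ∧ b ≠ c →
      q (T a b c) = SemidirectProduct.inr (doubleSwap a b b c))
    {a b c : Fin n} (h : a ≠ b ∧ a ≠ c ∧ b ≠ c) : T b c a = T a b c := by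
  have := hT _ _ a b c (hqT a b c h)
  rw [mul_inv_cancel_right] at this
  rw [← this]
  have hc := coe_doubleSwap_threeCycle h.1 h.2.2
  have e1 : doubleSwap a b b c • a = b :=
    (DFunLike.congr_fun hc a).trans (threeCycle_apply_left h.1 h.2.1)
  have e2 : doubleSwap a b b c • b = c :=
    (DFunLike.congr_fun hc b).trans (threeCycle_apply_mid h.2.1 h.2.2)
  have e3 : doubleSwap a b b c • c = a :=
    (DFunLike.congr_fun hc c).trans threeCycle_apply_right
  rw [e1, e2, e3]

/-- The central element that the lifts of the 3-cycles determine. -/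
theorem exists_threeCycle_constant (hn : 8 ≤ n) (hq : IsCentralExtension q)
    {T : Fin n → Fin n → Fin n → Y} (hT : EquivariantTriples q T)
    (hqT : ∀ a b c, a ≠ b ∧ a ≠ c ∧ b ≠ c →
      q (T a b c) = SemidirectProduct.inr (doubleSwap a b b c))
    (hinv : ∀ a b c, a ≠ b ∧ a ≠ c ∧ b ≠ c → T c b a = (T a b c)⁻¹)
    {a b : Fin n} (hab : a ≠ b) :
    ∃ z, q z = 1 ∧ z * z = 1 ∧ ∀ i j, i ≠ a → i ≠ b → j ≠ a → j ≠ b → i ≠ j →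
      (T i a b * T j a b) ^ 2 = z := by
  have hq1 : ∀ {i j}, i ≠ a → i ≠ b → j ≠ a → j ≠ b → i ≠ j →
      q ((T i a b * T j a b) ^ 2) = 1 := by
    intro i j hia hib hja hjb hij
    rw [map_pow, map_mul, hqT i a b ⟨hia, hib, hab⟩, hqT j a b ⟨hja, hjb, hab⟩, ← map_mul,
      threeCycle_mul_threeCycle hab hia hib hja hjb hij, ← map_pow, pow_two,
      doubleSwap_mul_self hia hjb hij hib hja.symm hab, map_one]
  obtain ⟨i₀, hi₀⟩ := exists_notMem_of_card (n := n) (s := {a, b})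
      (lt_of_le_of_lt Finset.card_le_two (by omega))
  obtain ⟨j₀, hj₀⟩ := exists_notMem_of_card (n := n) (s := {a, b, i₀})
      (lt_of_le_of_lt Finset.card_le_three (by omega))
  simp only [Finset.mem_insert, Finset.mem_singleton, not_or] at hi₀ hj₀
  have h0 : i₀ ≠ j₀ ∧ i₀ ≠ a ∧ i₀ ≠ b ∧ j₀ ≠ a ∧ j₀ ≠ b ∧ a ≠ b :=
    ⟨Ne.symm hj₀.2.2, hi₀.1, hi₀.2, hj₀.1, hj₀.2.1, hab⟩
  have hz := hq1 hi₀.1 hi₀.2 hj₀.1 hj₀.2.1 h0.1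
  refine ⟨_, hz, ?_, fun i j hia hib hja hjb hij => ?_⟩
  -- Conjugation by a lift of an even permutation that exchanges i₀ with j₀ and a with b replaces T
  -- i₀ a b * T j₀ a b by its inverse. As z is central, z = z⁻¹.
  · obtain ⟨g, g1, g2, g3, g4⟩ := exists_alternating_quad hn h0
      (i' := j₀) (j' := i₀) (k' := b) (l' := a)
      ⟨h0.1.symm, h0.2.2.2.2.1, h0.2.2.2.1, h0.2.2.1, h0.2.1, hab.symm⟩
    obtain ⟨y, hy⟩ := hq.1 (SemidirectProduct.inr g)
    have e1 := hT y g i₀ a b hy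
    have e2 := hT y g j₀ a b hy
    rw [g1, g3, g4] at e1
    rw [g2, g3, g4] at e2
    have r1 : T j₀ b a = (T j₀ a b)⁻¹ := by
      rw [← hinv _ _ _ ⟨hj₀.1, hj₀.2.1, hab⟩]
      exact (rotate_lift hT hqT ⟨h0.2.2.2.2.1, h0.2.2.2.1, hab.symm⟩).symm
    have r2 : T i₀ b a = (T i₀ a b)⁻¹ := by
      rw [← hinv _ _ _ ⟨hi₀.1, hi₀.2, hab⟩]
      exact (rotate_lift hT hqT ⟨h0.2.2.1, h0.2.1, hab.symm⟩).symm
    have hc := conj_eq_self_of_central hq (y := y) hz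
    rw [← conj_pow, show y * (T i₀ a b * T j₀ a b) * y⁻¹
      = (y * T i₀ a b * y⁻¹) * (y * T j₀ a b * y⁻¹) by group, ← e1, ← e2, r1, r2,
      ← mul_inv_rev, inv_pow] at hc
    rw [← inv_eq_iff_mul_eq_one, hc]
  · obtain ⟨g, g1, g2, g3, g4⟩ := exists_alternating_quad hn h0
      (i' := i) (j' := j) (k' := a) (l' := b) ⟨hij, hia, hib, hja, hjb, hab⟩
    obtain ⟨y, hy⟩ := hq.1 (SemidirectProduct.inr g)
    have e1 := hT y g i₀ a b hy
    have e2 := hT y g j₀ a b hy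
    rw [g1, g3, g4] at e1
    rw [g2, g3, g4] at e2
    rw [← conj_eq_self_of_central hq (y := y) hz, ← conj_pow, e1, e2]
    congr 1; group

/-- Equivariant lifts of the vectors `eᵢ + eⱼ`. -/
theorem exists_pair_lifts (hn : 8 ≤ n) (hq : IsCentralExtension q) :
    ∃ (S : Fin n → Fin n → Y) (c : Y), EquivariantPairs q S ∧ q c = 1 ∧ c * c = 1 ∧
      (∀ i j, i ≠ j → q (S i j) = SemidirectProduct.inl (pairVec i j)) ∧
      (∀ i j k, i ≠ j ∧ i ≠ k ∧ j ≠ k → S i j * S j k = S i k) ∧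
      (∀ i j, i ≠ j → S j i = c * S i j) ∧ (∀ i j, i ≠ j → S i j * S i j = c) ∧
      (∀ i j k, i ≠ j ∧ i ≠ k ∧ j ≠ k → S j k * S i j = c * (S i j * S j k)) := by
  obtain ⟨s, hs, hs'⟩ := exists_equivariant_lift_embedding hq (k := 2) (by omega)
    (fun i => SemidirectProduct.inl (pairVec (i 0) (i 1))) (fun g i => inr_mul_pairVec g _ _)
  let S₀ : Fin n → Fin n → Y := fun a b => if h : a ≠ b then s (pairEmb h) else 1
  have hS₀ : EquivariantPairs q S₀ := by
    intro y g a b hy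
    by_cases h : a ≠ b
    · have h' : g • a ≠ g • b := by simpa using h
      simp only [S₀, dif_pos h, dif_pos h']
      rw [← hs' y g _ hy]
      congr 1
      ext1 x
      fin_cases x <;> rfl
    · have h' : ¬ (g • a ≠ g • b) := by simpa using h
      simp only [S₀, dif_neg h, dif_neg h']; group
  have hqS₀ : ∀ a b, a ≠ b → q (S₀ a b) = SemidirectProduct.inl (pairVec a b) := by
    intro a b h
    simp only [S₀, dif_pos h, hs]
    rfl
  have hadd : ∀ a b c : Fin n, pairVec a b * pairVec b c = pairVec a c := by
    intro a b c
    apply Subtype.ext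
    apply Multiplicative.toAdd.injective
    funext k
    change (Pi.single a 1 : Fin n → ZMod 2) k + (Pi.single b 1 : Fin n → ZMod 2) k
      + ((Pi.single b 1 : Fin n → ZMod 2) k + (Pi.single c 1 : Fin n → ZMod 2) k)
      = (Pi.single a 1 : Fin n → ZMod 2) k + (Pi.single c 1 : Fin n → ZMod 2) k
    rw [add_assoc, ← add_assoc ((Pi.single b 1 : Fin n → ZMod 2) k), CharTwo.add_self_eq_zero,
      zero_add]
  have hcomm : ∀ a b : Fin n, pairVec a b = pairVec b a := fun a b =>
    Subtype.ext (congrArg Multiplicative.ofAdd (add_comm _ _))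
  -- The constant d is the defect of additivity. A factor d⁻¹ on each lift removes it, since it
  -- occurs twice on the left and once on the right.
  obtain ⟨d, hd, hd'⟩ := EquivariantTriples.const hn hq
    (u := fun a b c => S₀ a b * S₀ b c * (S₀ a c)⁻¹)
    (fun y g a b c hy => by simp only [hS₀ y g _ _ hy]; group) (fun a b c h => by
      rw [map_mul, map_mul, map_inv, hqS₀ _ _ h.1, hqS₀ _ _ h.2.2, hqS₀ _ _ h.2.1, ← map_mul,
        hadd, mul_inv_cancel])
  have hd1 : q d⁻¹ = 1 := by rw [map_inv, hd, inv_one]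
  obtain ⟨S, hSdef⟩ : ∃ S : Fin n → Fin n → Y, S = fun a b => S₀ a b * d⁻¹ := ⟨_, rfl⟩
  have hS : EquivariantPairs q S := by
    intro y g a b hy
    simp only [hSdef]
    rw [hS₀ y g a b hy, conj_mul_central hq hd1]
  have hqS : ∀ a b, a ≠ b → q (S a b) = SemidirectProduct.inl (pairVec a b) := by
    intro a b h
    simp only [hSdef]
    rw [map_mul, hd1, mul_one, hqS₀ a b h]
  have hSS : ∀ i j k, i ≠ j ∧ i ≠ k ∧ j ≠ k → S i j * S j k = S i k := by
    intro i j k h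
    have := hd' i j k h
    simp only [mul_inv_eq_iff_eq_mul] at this
    simp only [hSdef]
    calc S₀ i j * d⁻¹ * (S₀ j k * d⁻¹) = S₀ i j * (d⁻¹ * S₀ j k) * d⁻¹ := by group
      _ = (S₀ i j * S₀ j k) * d⁻¹ * d⁻¹ := by rw [← hq.comm hd1]; group
      _ = _ := by rw [this, ← hq.comm hd]; group
  -- The vector eᵢ + eⱼ is symmetric in i and j but its lift need not be; c measures the asymmetry.
  -- Exchanging twice gives c² = 1.
  obtain ⟨c, hc, hc'⟩ := EquivariantPairs.const hn hq (u := fun a b => S b a * (S a b)⁻¹)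
    (fun y g a b hy => by simp only [hS y g _ _ hy]; group) (fun a b h => by
      rw [map_mul, map_inv, hqS _ _ h, hqS _ _ h.symm, hcomm, mul_inv_cancel])
  have hflip : ∀ i j, i ≠ j → S j i = c * S i j := fun i j h =>
    mul_inv_eq_iff_eq_mul.1 (hc' i j h)
  have h01 : (⟨0, by omega⟩ : Fin n) ≠ ⟨1, by omega⟩ := by simp
  have hcc : c * c = 1 := by
    have h1 := hflip _ _ h01.symm
    rw [hflip _ _ h01, ← mul_assoc] at h1
    exact mul_eq_right.1 h1.symm
  -- Additivity along k, j, i, with all three lifts reversed, compares three factors c with the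
  -- product in the other order.
  have hanti : ∀ i j k, i ≠ j ∧ i ≠ k ∧ j ≠ k → S j k * S i j = c * (S i j * S j k) := by
    intro i j k h
    have h1 := hSS k j i ⟨h.2.2.symm, h.2.1.symm, h.1.symm⟩
    rw [hflip _ _ h.2.2, hflip _ _ h.1, hflip _ _ h.2.1, ← hSS i j k h,
      ← mul_assoc, mul_assoc c (S j k), hq.comm hc, ← mul_assoc, hcc, one_mul] at h1
    exact h1
  have hsq : ∀ j k, j ≠ k → S j k * S j k = c := by
    intro j k h
    obtain ⟨i, hi⟩ := exists_notMem_of_card (n := n) (s := {j, k})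
      (lt_of_le_of_lt Finset.card_le_two (by omega))
    simp only [Finset.mem_insert, Finset.mem_singleton, not_or] at hi
    -- Going i → j → k → j must agree with i → j, which forces c S(j,k)² = 1.
    have h1 := hSS i k j ⟨hi.2, hi.1, h.symm⟩
    rw [← hSS i j k ⟨hi.1, hi.2, h⟩, hflip _ _ h, ← hq.comm hc, mul_assoc,
      mul_eq_left, ← mul_assoc] at h1
    rw [← mul_one (S j k * S j k), ← hcc, ← mul_assoc, h1, one_mul]
  exact ⟨S, c, hS, hc, hcc, hqS, hSS, hflip, hsq, hanti⟩

end CanonicalLifts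

/-! ### The subgroup generated by the canonical lifts -/

section Section

variable {n : ℕ}

/-- The `k`-th coordinate of an even vector. -/
def evenCoord (k : Fin n) : evenBinary n →* Multiplicative (ZMod 2) where
  toFun v := Multiplicative.ofAdd ((v : BinaryWords n).toAdd k)
  map_one' := rfl
  map_mul' _ _ := rfl

theorem evenCoord_pairVec (k i j : Fin n) : evenCoord k (pairVec i j)
    = Multiplicative.ofAdd ((if k = i then 1 else 0) + (if k = j then 1 else 0) : ZMod 2) := by
  simp only [evenCoord, MonoidHom.coe_mk, OneHom.coe_mk, coe_pairVec, Pi.add_apply, Pi.single_apply]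

theorem evenBinary_ext {v w : evenBinary n} (h : ∀ k, evenCoord k v = evenCoord k w) : v = w := by
  apply Subtype.ext
  apply Multiplicative.toAdd.injective
  funext k
  exact congrArg Multiplicative.toAdd (h k)

theorem pairVec_self (a : Fin n) : pairVec a a = 1 :=
  evenBinary_ext fun k => by
    rw [evenCoord_pairVec, CharTwo.add_self_eq_zero, map_one]; rfl

/-- An even vector v equals the sum of vᵢ(eᵢ + eₐ): the extra multiple of eₐ is the coordinate sum,
which vanishes. -/
theorem closure_pairVec_eq_top (a : Fin n) :
    Subgroup.closure ((fun i => pairVec i a) '' {i | i ≠ a}) = ⊤ := by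
  rw [eq_top_iff]
  intro v _
  have hv : v = ∏ i, pairVec i a ^ ((v : BinaryWords n).toAdd i).val := by
    refine evenBinary_ext fun k => ?_
    rw [map_prod]
    simp only [map_pow, evenCoord_pairVec, ← ofAdd_nsmul]
    rw [← ofAdd_sum]
    refine congrArg Multiplicative.ofAdd ?_
    have hs : ∑ i, (v : BinaryWords n).toAdd i = 0 := by
      have : coordSum n v = 1 := v.2
      exact congrArg Multiplicative.toAdd this
    simp only [nsmul_eq_mul, ZMod.natCast_val, ZMod.cast_id', id_eq, mul_add, mul_ite, mul_one,
      mul_zero, Finset.sum_add_distrib, Finset.sum_ite_eq, Finset.mem_univ, if_true]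
    by_cases hk : k = a
    · simp [hk, hs]
    · simp [hk]
  rw [hv]
  refine Subgroup.prod_mem _ fun i _ => Subgroup.pow_mem _ ?_ _
  by_cases hi : i = a
  · rw [hi, pairVec_self]; exact Subgroup.one_mem _
  · exact Subgroup.subset_closure ⟨i, hi, rfl⟩

theorem eq_one_or_eq_of_mem_zpowers {Y : Type*} [Group Y] {z w : Y} (hz : z * z = 1)
    (hw : w ∈ Subgroup.zpowers z) : w = 1 ∨ w = z := by
  obtain ⟨m, rfl⟩ := hw
  simp only
  rcases Int.even_or_odd' m with ⟨k, rfl | rfl⟩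
  · left; rw [zpow_mul, zpow_ofNat, pow_two, hz, one_zpow]
  · right; rw [zpow_add, zpow_mul, zpow_ofNat, pow_two, hz, one_zpow, zpow_one, one_mul]

/-- A central extension of `Aₙ ⋉ (𝔽₂ⁿ)ᵉᵛ` contains a subgroup that covers the base and whose
kernel is generated by two distinguished elements `z` and `c` of order at most two: the square of
a lift of a double transposition, and the commutator of lifts of `eᵢ + eₐ` and `eₐ + e_b`. -/
theorem exists_covering_subgroup (hn : 8 ≤ n) {Y : Type*} [Group Y] {q : Y →* EvenSignedAlt n}
    (hq : IsCentralExtension q) {i₀ a j₀ b : Fin n} (h0 : i₀ ≠ a ∧ i₀ ≠ j₀ ∧ i₀ ≠ b ∧ a ≠ j₀ ∧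
      a ≠ b ∧ j₀ ≠ b) :
    ∃ (K : Subgroup Y) (z c : Y), K.map q = ⊤ ∧
      (∀ k ∈ K, q k = 1 → k = 1 ∨ k = z ∨ k = c ∨ k = z * c) ∧
      (∃ d, q d = SemidirectProduct.inr (doubleSwap i₀ a j₀ b) ∧ z = d * d) ∧
      (∃ s t, q s = SemidirectProduct.inl (pairVec i₀ a) ∧
        q t = SemidirectProduct.inl (pairVec a b) ∧ c = ⁅s, t⁆) := by
  obtain ⟨T, hT, hqT, hT3, hTinv⟩ := exists_threeCycle_lifts hn hq
  obtain ⟨z, hz, hzz, hTz⟩ := exists_threeCycle_constant hn hq hT hqT hTinv h0.2.2.2.2.1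
  obtain ⟨S, c, hS, hc, hcc, hqS, hSS, hflip, hsq, hanti⟩ := exists_pair_lifts hn hq
  have hab : a ≠ b := h0.2.2.2.2.1
  have hnorm : ∀ u, q u = 1 → (Subgroup.zpowers u).Normal := fun u hu =>
    ⟨fun v hv g => by
      rw [conj_eq_self_of_central hq]
      · exact hv
      · exact (Subgroup.zpowers_le (H := q.ker)).2 hu hv⟩
  set F : Finset (Fin n) := Finset.univ.filter fun i => i ≠ a ∧ i ≠ b with hF
  set F' : Finset (Fin n) := Finset.univ.erase a with hF'
  have memF : ∀ i, i ∈ F ↔ i ≠ a ∧ i ≠ b := fun i => by simp [hF]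
  have memF' : ∀ i, i ∈ F' ↔ i ≠ a := fun i => by simp [hF']
  set N := Subgroup.closure ((fun i => T i a b) '' F) with hN
  set M := Subgroup.closure ((fun i => S i a) '' F') with hM
  have hSinv : ∀ i j, i ≠ j → S j i = (S i j)⁻¹ := fun i j h => by
    rw [eq_inv_iff_mul_eq_one, hflip i j h, mul_assoc, hsq i j h, hcc]
  have hSM : ∀ i j, i ≠ j → S i j ∈ M := by
    intro i j hij
    have h1 : ∀ k, k ≠ a → S k a ∈ M := fun k hk =>
      Subgroup.subset_closure ⟨k, (memF' k).2 hk, rfl⟩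
    by_cases hi : i = a
    · rw [hi, hSinv j a (fun h => hij (by rw [hi, h]))]
      exact M.inv_mem (h1 j fun h => hij (by rw [hi, h]))
    by_cases hj : j = a
    · rw [hj]; exact h1 i hi
    · rw [← hSS i a j ⟨hi, hij, Ne.symm hj⟩, hSinv j a hj]
      exact M.mul_mem (h1 i hi) (M.inv_mem (h1 j hj))
  have hNA : ∀ t ∈ N, ∃ g, q t = SemidirectProduct.inr g := by
    have : N ≤ (SemidirectProduct.inr : alternatingGroup (Fin n) →* EvenSignedAlt n).range.comap
        q := by
      rw [hN, Subgroup.closure_le]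
      rintro _ ⟨i, hi, rfl⟩
      have hi := (memF i).1 hi
      exact ⟨_, (hqT i a b ⟨hi.1, hi.2, hab⟩).symm⟩
    intro t ht
    obtain ⟨g, hg⟩ := this ht
    exact ⟨g, hg.symm⟩
  have hMV : ∀ m ∈ M, ∃ v, q m = SemidirectProduct.inl v := by
    have : M ≤ (SemidirectProduct.inl : evenBinary n →* EvenSignedAlt n).range.comap q := by
      rw [hM, Subgroup.closure_le]
      rintro _ ⟨i, hi, rfl⟩
      exact ⟨_, (hqS i a ((memF' i).1 hi)).symm⟩
    intro t ht
    obtain ⟨g, hg⟩ := this ht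
    exact ⟨g, hg.symm⟩
  -- Elements of N lie over even permutations, so conjugation by them permutes the S i j by
  -- equivariance. Hence the join of M and N is the product MN.
  have hnormal : N ≤ Subgroup.normalizer M := by
    rw [hM, Subgroup.le_normalizer_closure_iff]
    rintro t ht _ ⟨i, hi, rfl⟩
    obtain ⟨g, hg⟩ := hNA t ht
    simp only
    rw [← hS t g i a hg]
    exact hSM _ _ (by simpa using (memF' i).1 hi)
  have hqN : N.map q = (SemidirectProduct.inr :
      alternatingGroup (Fin n) →* EvenSignedAlt n).range := by
    rw [MonoidHom.range_eq_map, ← closure_threeCycle_eq_top hab, hN, MonoidHom.map_closure,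
      MonoidHom.map_closure, ← Set.image_comp, ← Set.image_comp]
    congr 1
    have : (F : Set (Fin n)) = {i | i ≠ a ∧ i ≠ b} := Set.ext fun i => memF i
    rw [this]
    exact Set.image_congr fun i hi => hqT i a b ⟨hi.1, hi.2, hab⟩
  have hqM : M.map q = (SemidirectProduct.inl : evenBinary n →* EvenSignedAlt n).range := by
    rw [MonoidHom.range_eq_map, ← closure_pairVec_eq_top a, hM, MonoidHom.map_closure,
      MonoidHom.map_closure, ← Set.image_comp, ← Set.image_comp]
    congr 1
    have : (F' : Set (Fin n)) = {i | i ≠ a} := Set.ext fun i => memF' i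
    rw [this]
    exact Set.image_congr fun i hi => hqS i a hi
  refine ⟨M ⊔ N, z, c, ?_, ?_, ⟨T i₀ a b * T j₀ a b, ?_, ?_⟩, ⟨S i₀ a, S a b, hqS _ _ h0.1,
    hqS _ _ hab, ?_⟩⟩
  · rw [Subgroup.map_sup, hqM, hqN, eq_top_iff]
    intro g _
    rw [← SemidirectProduct.inl_left_mul_inr_right g]
    exact Subgroup.mul_mem_sup ⟨_, rfl⟩ ⟨_, rfl⟩
  · intro k hk hqk
    rw [← SetLike.mem_coe, Subgroup.coe_mul_of_right_le_normalizer_left M N hnormal] at hk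
    obtain ⟨m, hm, t, ht, rfl⟩ := hk
    simp only at hqk ⊢
    -- M and N lie over complementary factors, so both m and t lie over 1 and can be treated
    -- separately.
    obtain ⟨v, hv⟩ := hMV m hm
    obtain ⟨g, hg⟩ := hNA t ht
    have hg1 : g = 1 := by
      have := congrArg SemidirectProduct.rightHom hqk
      rw [map_mul, hv, hg] at this
      simpa using this
    have hqt : q t = 1 := by rw [hg, hg1, map_one]
    have hqm : q m = 1 := by simpa [hqt] using hqk
    -- Modulo z, the T i a b satisfy Carmichael's relations.
    have htz : t ∈ Subgroup.zpowers z := by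
      have := hnorm z hz
      refine mem_of_mem_closure_threeCycles
        ((alternatingGroup (Fin n)).subtype.comp (SemidirectProduct.rightHom.comp q))
        (Subgroup.zpowers z) ?_ (a := a) (b := b) (fun i => T i a b) F
        (fun h => ((memF a).1 h).1 rfl) (fun h => ((memF b).1 h).2 rfl) (fun i hi => ?_)
        (fun i hi j hj hij => ?_) (fun i hi => ?_) ht ?_
      · rw [Subgroup.zpowers_le]
        simp [MonoidHom.mem_ker, hz]
      · rw [hT3 i a b ⟨((memF i).1 hi).1, ((memF i).1 hi).2, hab⟩]
        exact Subgroup.one_mem _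
      · rw [hTz i j ((memF i).1 hi).1 ((memF i).1 hi).2 ((memF j).1 hj).1 ((memF j).1 hj).2 hij]
        exact Subgroup.mem_zpowers z
      · have hi := (memF i).1 hi
        simp only [MonoidHom.comp_apply, hqT i a b ⟨hi.1, hi.2, hab⟩,
          SemidirectProduct.rightHom_inr]
        exact coe_doubleSwap_threeCycle hi.1 hab
      · simp only [MonoidHom.comp_apply, hqt, map_one]
    -- Modulo c, the S i a are commuting involutions. For i ≠ a the i-th coordinate of eⱼ + eₐ is
    -- nonzero only for j = i, so the lifts of vectors with vanishing i-th coordinate separate them.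
    have hmc : m ∈ Subgroup.zpowers c := by
      have := hnorm c hc
      have hmem : ∀ i j, j ≠ a → (S j a ∈ ((evenCoord i).ker.map (SemidirectProduct.inl :
          evenBinary n →* EvenSignedAlt n)).comap q ↔ evenCoord i (pairVec j a) = 1) := by
        intro i j hj
        rw [Subgroup.mem_comap, hqS j a hj,
          Subgroup.mem_map_iff_mem SemidirectProduct.inl_injective, MonoidHom.mem_ker]
      refine mem_of_mem_closure_involutions (Subgroup.zpowers c) (fun i => S i a)
        (fun i => ((evenCoord i).ker.map (SemidirectProduct.inl :
          evenBinary n →* EvenSignedAlt n)).comap q) F' (fun i hi => ?_) (fun i hi => ?_)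
        (fun i hi j hj => ?_) (fun i hi j hj hij => ?_) (fun i hi => ?_) hm (fun i hi => ?_)
      · rw [Subgroup.zpowers_le, Subgroup.mem_comap, hc]
        exact Subgroup.one_mem _
      · rw [hsq i a ((memF' i).1 hi)]
        exact Subgroup.mem_zpowers c
      · by_cases hij : i = j
        · rw [hij, inv_mul_cancel]; exact Subgroup.one_mem _
        · have hi := (memF' i).1 hi
          have hj := (memF' j).1 hj
          have h1 := hanti j a i ⟨hj, Ne.symm hij, Ne.symm hi⟩
          rw [hflip i a hi, mul_assoc, mul_left_cancel_iff, ← hq.comm hc (S i a),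
            ← mul_assoc] at h1
          rw [h1, mul_inv_rev, inv_mul_cancel_right]
          exact Subgroup.inv_mem _ (Subgroup.mem_zpowers c)
      · have hi := (memF' i).1 hi
        rw [hmem i j ((memF' j).1 hj), evenCoord_pairVec, if_neg (Ne.symm hij), if_neg hi]
        rfl
      · have hi := (memF' i).1 hi
        rw [hmem i i hi, evenCoord_pairVec, if_pos rfl, if_neg hi]
        decide
      · rw [Subgroup.mem_comap, hqm]
        exact Subgroup.one_mem _
    rcases eq_one_or_eq_of_mem_zpowers hzz htz with rfl | rfl <;>
      rcases eq_one_or_eq_of_mem_zpowers hcc hmc with rfl | rfl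
    · simp
    · simp
    · simp
    · exact Or.inr (Or.inr (Or.inr (hq.comm hz _)))
  · rw [map_mul, hqT _ _ _ ⟨h0.1, h0.2.2.1, hab⟩, hqT _ _ _ ⟨h0.2.2.2.1.symm, h0.2.2.2.2.2, hab⟩,
      ← map_mul, threeCycle_mul_threeCycle hab h0.1 h0.2.2.1 h0.2.2.2.1.symm h0.2.2.2.2.2 h0.2.1]
  · rw [← pow_two, hTz _ _ h0.1 h0.2.2.1 h0.2.2.2.1.symm h0.2.2.2.2.2 h0.2.1]
  · have h1 := hanti i₀ a b ⟨h0.1, h0.2.2.1, hab⟩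
    rw [commutatorElement_def, mul_assoc, ← mul_inv_rev, h1, mul_inv_rev, mul_inv_cancel_left,
      eq_inv_iff_mul_eq_one, hcc]

end Section

/-! ### The Clifford algebra and the spin group -/

section Spin

variable {n : ℕ}

theorem stdForm_apply (v : Fin n → ℝ) : stdForm n v = -∑ i, v i * v i := by
  simp [stdForm, QuadraticMap.weightedSumSquares_apply]

theorem cliffordBasis_mul_self (i : Fin n) :
    (cliffordBasis i * cliffordBasis i : CliffordAlgebra (stdForm n)) = -1 := by
  rw [cliffordBasis, CliffordAlgebra.ι_sq_scalar, stdForm_apply]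
  simp [Pi.single_apply]

theorem cliffordBasis_anticomm {i j : Fin n} (h : i ≠ j) :
    (cliffordBasis i * cliffordBasis j : CliffordAlgebra (stdForm n))
      = -(cliffordBasis j * cliffordBasis i) := by
  refine CliffordAlgebra.ι_mul_ι_comm_of_isOrtho ?_
  rw [QuadraticMap.isOrtho_def]
  simp only [stdForm_apply, Pi.add_apply, mul_add, add_mul, Finset.sum_add_distrib]
  simp [Pi.single_apply, h, h.symm]

theorem clifford_neg_one_ne_one : (-1 : CliffordAlgebra (stdForm n)) ≠ 1 := by
  intro h
  have h1 : algebraMap ℝ (CliffordAlgebra (stdForm n)) (-1) = algebraMap ℝ _ 1 := by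
    simpa using h
  have := (algebraMap ℝ (CliffordAlgebra (stdForm n))).injective h1
  norm_num at this

/-- The unit vector `(eₐ - e_b) / √2` in the Clifford algebra. -/
noncomputable def rootVec (a b : Fin n) : CliffordAlgebra (stdForm n) :=
  CliffordAlgebra.ι (stdForm n) ((√2)⁻¹ • (Pi.single a 1 - Pi.single b 1))

theorem rootVec_eq (a b : Fin n) :
    rootVec a b = (√2 : ℝ)⁻¹ • (cliffordBasis a - cliffordBasis b) := by
  simp [rootVec, cliffordBasis]

theorem rootVec_mul_self {a b : Fin n} (h : a ≠ b) : rootVec a b * rootVec a b = -1 := by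
  rw [rootVec_eq, smul_mul_smul_comm, ← mul_inv, Real.mul_self_sqrt (by norm_num), sub_mul,
    mul_sub, mul_sub, cliffordBasis_mul_self, cliffordBasis_mul_self, cliffordBasis_anticomm h]
  rw [show (-1 - -(cliffordBasis b * cliffordBasis a) - (cliffordBasis b * cliffordBasis a - -1)
    : CliffordAlgebra (stdForm n)) = (2 : ℝ) • (-1) by rw [two_smul]; abel, smul_smul]
  norm_num

theorem rootVec_anticomm {a b c d : Fin n} (hac : a ≠ c) (had : a ≠ d) (hbc : b ≠ c)
    (hbd : b ≠ d) : rootVec a b * rootVec c d = -(rootVec c d * rootVec a b) := by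
  rw [rootVec_eq, rootVec_eq, smul_mul_smul_comm, smul_mul_smul_comm, ← smul_neg]
  congr 1
  simp only [sub_mul, mul_sub]
  rw [cliffordBasis_anticomm hac, cliffordBasis_anticomm had, cliffordBasis_anticomm hbc,
    cliffordBasis_anticomm hbd]
  abel

/-- The reflection in `rootVec a b` exchanges `eₐ` and `e_b`. -/
theorem rootVec_mul_cliffordBasis {a b : Fin n} (hab : a ≠ b) (i : Fin n) :
    rootVec a b * cliffordBasis i = -(cliffordBasis (Equiv.swap a b i) * rootVec a b) := by
  rw [rootVec_eq, smul_mul_assoc, mul_smul_comm, ← smul_neg]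
  congr 1
  rw [sub_mul, mul_sub]
  by_cases ha : i = a
  · subst ha
    rw [Equiv.swap_apply_left, cliffordBasis_mul_self, cliffordBasis_mul_self]
    abel
  by_cases hb : i = b
  · subst hb
    rw [Equiv.swap_apply_right, cliffordBasis_mul_self, cliffordBasis_mul_self]
    abel
  · rw [Equiv.swap_apply_of_ne_of_ne ha hb, cliffordBasis_anticomm ha, cliffordBasis_anticomm hb]
    abel

/-- Such a vector has inverse -v, which is also its conjugate under `star`. -/
theorem ι_mem_pinGroup {v : Fin n → ℝ}
    (h : CliffordAlgebra.ι (stdForm n) v * CliffordAlgebra.ι (stdForm n) v = -1) :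
    CliffordAlgebra.ι (stdForm n) v ∈ pinGroup (stdForm n) := by
  have h' : CliffordAlgebra.ι (stdForm n) v * -CliffordAlgebra.ι (stdForm n) v = 1 := by
    rw [mul_neg, h, neg_neg]
  have h'' : -CliffordAlgebra.ι (stdForm n) v * CliffordAlgebra.ι (stdForm n) v = 1 := by
    rw [neg_mul, h, neg_neg]
  rw [pinGroup.mem_iff]
  refine ⟨⟨⟨_, _, h', h''⟩, Subgroup.subset_closure ⟨v, rfl⟩, rfl⟩, ?_⟩
  rw [Unitary.mem_iff, CliffordAlgebra.star_ι]
  exact ⟨h'', h'⟩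

theorem ι_mul_ι_mem_spinGroup {v w : Fin n → ℝ}
    (hv : CliffordAlgebra.ι (stdForm n) v * CliffordAlgebra.ι (stdForm n) v = -1)
    (hw : CliffordAlgebra.ι (stdForm n) w * CliffordAlgebra.ι (stdForm n) w = -1) :
    CliffordAlgebra.ι (stdForm n) v * CliffordAlgebra.ι (stdForm n) w ∈ spinGroup (stdForm n) :=
  spinGroup.mem_iff.2 ⟨mul_mem (ι_mem_pinGroup hv) (ι_mem_pinGroup hw),
    CliffordAlgebra.ι_mul_ι_mem_evenOdd_zero _ _ _⟩

/-- The lift of the product of the transpositions `(a b)` and `(c d)` to the spin group. -/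
noncomputable def spinDoubleSwap {a b c d : Fin n} (hab : a ≠ b) (hcd : c ≠ d) : SpinAlt n :=
  ⟨(⟨rootVec a b * rootVec c d,
    ι_mul_ι_mem_spinGroup (rootVec_mul_self hab) (rootVec_mul_self hcd)⟩, doubleSwap a b c d), by
    intro i
    -- Each reflection contributes a sign, and the two signs cancel.
    rw [coe_doubleSwap hab hcd]
    simp only [Equiv.Perm.mul_apply]
    rw [mul_assoc, rootVec_mul_cliffordBasis hcd, mul_neg, ← mul_assoc,
      rootVec_mul_cliffordBasis hab, neg_mul, neg_neg, mul_assoc]⟩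

theorem spinAltProj_spinDoubleSwap {a b c d : Fin n} (hab : a ≠ b) (hcd : c ≠ d) :
    spinAltProj n (spinDoubleSwap hab hcd) = doubleSwap a b c d := rfl

/-- The element `-1` of the spin group. -/
def negSpin (hn : 0 < n) : SpinAlt n :=
  ⟨(⟨-1, by
    have h := cliffordBasis_mul_self (⟨0, hn⟩ : Fin n)
    rw [← h]
    exact ι_mul_ι_mem_spinGroup h h⟩, 1), by
    intro i
    simp⟩

theorem SpinAlt.ext' {x y : SpinAlt n}
    (h1 : (x.1.1 : CliffordAlgebra (stdForm n)) = y.1.1) (h2 : x.1.2 = y.1.2) : x = y :=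
  Subtype.ext (Prod.ext (Subtype.ext h1) h2)

theorem negSpin_ne_one (hn : 0 < n) : negSpin hn ≠ 1 := fun h =>
  clifford_neg_one_ne_one (n := n) (congrArg (fun x : SpinAlt n =>
    (x.1.1 : CliffordAlgebra (stdForm n))) h)

theorem negSpin_comm (hn : 0 < n) (x : SpinAlt n) : negSpin hn * x = x * negSpin hn :=
  SpinAlt.ext' (show (-1 : CliffordAlgebra (stdForm n)) * _ = _ * -1 by simp)
    (show 1 * _ = _ * 1 by simp)

theorem negSpin_mul_self (hn : 0 < n) : negSpin hn * negSpin hn = 1 :=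
  SpinAlt.ext' (show (-1 : CliffordAlgebra (stdForm n)) * -1 = 1 by simp)
    (show (1 : alternatingGroup (Fin n)) * 1 = 1 by simp)

/-- For anticommuting r and s with r² = -1, one has r s r = -s r² = s. -/
theorem rootVec_mul_rootVec_mul {a b c d : Fin n} (hab : a ≠ b) (hac : a ≠ c) (had : a ≠ d)
    (hbc : b ≠ c) (hbd : b ≠ d) (x : CliffordAlgebra (stdForm n)) :
    rootVec a b * rootVec c d * (rootVec a b * x) = rootVec c d * x := by
  rw [rootVec_anticomm hac had hbc hbd, neg_mul, mul_assoc, ← mul_assoc (rootVec a b),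
    rootVec_mul_self hab, neg_one_mul, mul_neg, neg_neg]

theorem swap_mul_swap_mul {a b c d : Fin n} (hac : a ≠ c) (had : a ≠ d)
    (hbc : b ≠ c) (hbd : b ≠ d) (x : Equiv.Perm (Fin n)) :
    Equiv.swap a b * Equiv.swap c d * (Equiv.swap a b * x) = Equiv.swap c d * x := by
  have h := Equiv.swap_apply_apply (Equiv.swap a b) c d
  rw [Equiv.swap_apply_of_ne_of_ne hac.symm hbc.symm,
    Equiv.swap_apply_of_ne_of_ne had.symm hbd.symm, eq_mul_inv_iff_mul_eq] at h
  rw [← h, mul_assoc, ← mul_assoc (Equiv.swap a b), Equiv.swap_mul_self, one_mul]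

theorem spinDoubleSwap_mul_self (hn : 0 < n) {a b c d : Fin n} (hab : a ≠ b) (hcd : c ≠ d)
    (hac : a ≠ c) (had : a ≠ d) (hbc : b ≠ c) (hbd : b ≠ d) :
    spinDoubleSwap hab hcd * spinDoubleSwap hab hcd = negSpin hn :=
  SpinAlt.ext' ((rootVec_mul_rootVec_mul hab hac had hbc hbd _).trans (rootVec_mul_self hcd))
    (doubleSwap_mul_self hab hcd hac had hbc hbd)

/-- With a common first root r, (rs)(rt) = st and (rt)(rs) = ts = -st. This exhibits the spin -1 as
a commutator, as the perfectness of Ãₙ ⋉ Fₙᵉᵛ requires. -/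
theorem spinDoubleSwap_commutator (hn : 0 < n) {a b c d e f : Fin n} (hab : a ≠ b) (hcd : c ≠ d)
    (hef : e ≠ f) (hac : a ≠ c) (had : a ≠ d) (hbc : b ≠ c) (hbd : b ≠ d) (hae : a ≠ e)
    (haf : a ≠ f) (hbe : b ≠ e) (hbf : b ≠ f) (hce : c ≠ e) (hcf : c ≠ f) (hde : d ≠ e)
    (hdf : d ≠ f) :
    ⁅spinDoubleSwap hab hcd, spinDoubleSwap hab hef⁆ = negSpin hn := by
  rw [commutatorElement_def, mul_assoc, ← mul_inv_rev, mul_inv_eq_iff_eq_mul]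
  refine SpinAlt.ext' ?_ ?_
  · change rootVec a b * rootVec c d * (rootVec a b * rootVec e f)
      = -1 * (rootVec a b * rootVec e f * (rootVec a b * rootVec c d))
    rw [rootVec_mul_rootVec_mul hab hac had hbc hbd, rootVec_mul_rootVec_mul hab hae haf hbe hbf,
      neg_one_mul, rootVec_anticomm hce hcf hde hdf]
  · change doubleSwap a b c d * doubleSwap a b e f
      = 1 * (doubleSwap a b e f * doubleSwap a b c d)
    apply Subtype.ext
    simp only [one_mul, Subgroup.coe_mul, coe_doubleSwap hab hcd, coe_doubleSwap hab hef]
    rw [swap_mul_swap_mul hac had hbc hbd, swap_mul_swap_mul hae haf hbe hbf,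
      ← swap_mul_swap_mul hce hcf hde hdf (Equiv.swap c d), Equiv.swap_mul_self, mul_one]

theorem spinAltProj_surjective (hn : 8 ≤ n) : Function.Surjective (spinAltProj n) := by
  rw [← MonoidHom.range_eq_top, eq_top_iff,
    ← closure_threeCycle_eq_top (a := (⟨0, by omega⟩ : Fin n)) (b := ⟨1, by omega⟩) (by simp),
    Subgroup.closure_le]
  rintro _ ⟨i, hi, rfl⟩
  exact ⟨spinDoubleSwap hi.1 (by simp), rfl⟩

-- Every generator indexed by F anticommutes with e_p, so moving e_p across x costs exactly the
-- grading sign.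
open CliffordAlgebra in
theorem mul_cliffordBasis_of_mem_adjoin {F : Finset (Fin n)} {p : Fin n} (hp : p ∉ F)
    {x : CliffordAlgebra (stdForm n)}
    (hx : x ∈ Algebra.adjoin ℝ (cliffordBasis '' (F : Set (Fin n)))) :
    involute x ∈ Algebra.adjoin ℝ (cliffordBasis '' (F : Set (Fin n))) ∧
      x * cliffordBasis p = cliffordBasis p * involute x := by
  induction hx using Algebra.adjoin_induction with
  | mem x hx =>
    have hmem := Algebra.subset_adjoin (R := ℝ) hx
    obtain ⟨i, hi, rfl⟩ := hx
    have hinv : involute (cliffordBasis i) = -(cliffordBasis i : CliffordAlgebra (stdForm n)) :=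
      involute_ι _
    rw [hinv]
    refine ⟨neg_mem hmem, ?_⟩
    rw [cliffordBasis_anticomm (i := i) (j := p) (fun h => hp (h ▸ hi)), mul_neg]
  | algebraMap r =>
    rw [AlgHom.commutes]
    exact ⟨Subalgebra.algebraMap_mem _ r, Algebra.commutes _ _⟩
  | add x y _ _ hx hy =>
    rw [map_add]
    exact ⟨add_mem hx.1 hy.1, by rw [add_mul, mul_add, hx.2, hy.2]⟩
  | mul x y _ _ hx hy =>
    rw [map_mul]
    exact ⟨mul_mem hx.1 hy.1, by rw [mul_assoc, hy.2, ← mul_assoc, hx.2, mul_assoc]⟩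

-- Expressions a + e_p b are closed under multiplication, since e_p can be moved to the left at the
-- cost of `involute` and e_p² = -1. No basis of the Clifford algebra is needed, and uniqueness of a
-- and b plays no role.
open CliffordAlgebra in
theorem exists_decomposition {F : Finset (Fin n)} {p : Fin n} (hp : p ∉ F)
    {x : CliffordAlgebra (stdForm n)}
    (hx : x ∈ Algebra.adjoin ℝ (cliffordBasis '' ((insert p F : Finset (Fin n)) : Set (Fin n)))) :
    ∃ a ∈ Algebra.adjoin ℝ (cliffordBasis '' (F : Set (Fin n))),
      ∃ b ∈ Algebra.adjoin ℝ (cliffordBasis '' (F : Set (Fin n))),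
        x = a + cliffordBasis p * b := by
  induction hx using Algebra.adjoin_induction with
  | mem x hx =>
    obtain ⟨i, hi, rfl⟩ := hx
    rcases Finset.mem_insert.1 hi with rfl | hi
    · exact ⟨0, zero_mem _, 1, one_mem _, by simp⟩
    · exact ⟨_, Algebra.subset_adjoin ⟨i, hi, rfl⟩, 0, zero_mem _, by simp⟩
  | algebraMap r => exact ⟨_, Subalgebra.algebraMap_mem _ r, 0, zero_mem _, by simp⟩
  | add x y _ _ hx hy =>
    obtain ⟨a, ha, b, hb, rfl⟩ := hx
    obtain ⟨a', ha', b', hb', rfl⟩ := hy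
    exact ⟨a + a', add_mem ha ha', b + b', add_mem hb hb', by rw [mul_add]; abel⟩
  | mul x y _ _ hx hy =>
    obtain ⟨a, ha, b, hb, rfl⟩ := hx
    obtain ⟨a', ha', b', hb', rfl⟩ := hy
    obtain ⟨ia, ea⟩ := mul_cliffordBasis_of_mem_adjoin hp ha
    obtain ⟨ib, eb⟩ := mul_cliffordBasis_of_mem_adjoin hp hb
    refine ⟨a * a' - involute b * b', sub_mem (mul_mem ha ha') (mul_mem ib hb'),
      involute a * b' + b * a', add_mem (mul_mem ia hb') (mul_mem hb ha'), ?_⟩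
    calc (a + cliffordBasis p * b) * (a' + cliffordBasis p * b')
        = a * a' + (a * cliffordBasis p) * b' + cliffordBasis p * (b * a')
          + cliffordBasis p * (b * cliffordBasis p) * b' := by noncomm_ring
      _ = a * a' + cliffordBasis p * (involute a * b') + cliffordBasis p * (b * a')
          + (cliffordBasis p * cliffordBasis p) * (involute b * b') := by
          rw [ea, eb]; noncomm_ring
      _ = _ := by rw [cliffordBasis_mul_self]; noncomm_ring

open CliffordAlgebra in
/-- An even element of the Clifford algebra that commutes with all vectors is a scalar. -/
theorem exists_eq_algebraMap_of_even_central {x : CliffordAlgebra (stdForm n)}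
    (hx : involute x = x) (hc : ∀ i, x * cliffordBasis i = cliffordBasis i * x) :
    ∃ r : ℝ, x = algebraMap ℝ _ r := by
  -- Generators are eliminated one by one until x lies in the scalars.
  have key : ∀ F : Finset (Fin n), x ∈ Algebra.adjoin ℝ (cliffordBasis '' (F : Set (Fin n))) →
      ∃ r : ℝ, x = algebraMap ℝ _ r := by
    intro F
    induction F using Finset.induction_on with
    | empty =>
      intro h
      rw [Finset.coe_empty, Set.image_empty, Algebra.adjoin_empty, Algebra.mem_bot] at h
      obtain ⟨r, hr⟩ := h
      exact ⟨r, hr.symm⟩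
    | insert p F hp ih =>
      intro h
      obtain ⟨a, ha, b, hb, hab⟩ := exists_decomposition hp h
      obtain ⟨-, ea⟩ := mul_cliffordBasis_of_mem_adjoin hp ha
      obtain ⟨-, eb⟩ := mul_cliffordBasis_of_mem_adjoin hp hb
      have hcancel : ∀ u v : CliffordAlgebra (stdForm n),
          cliffordBasis p * u = cliffordBasis p * v → u = v := by
        intro u v h
        have := congrArg (cliffordBasis p * ·) h
        simp only [← mul_assoc, cliffordBasis_mul_self, neg_one_mul, neg_inj] at this
        exact this
      -- Commutation with e_p gives x = a' + e_p b', and evenness gives x = a' - e_p b', where ' is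
      -- the grade involution. Hence b = 0 and e_p does not occur in x.
      have h1 : involute a + cliffordBasis p * involute b = a + cliffordBasis p * b := by
        apply hcancel
        rw [← hab, ← hc p, hab, add_mul, ea, mul_assoc, eb, mul_add]
      have hp' : involute (cliffordBasis p) = -(cliffordBasis p : CliffordAlgebra (stdForm n)) :=
        involute_ι _
      have h2 : involute a - cliffordBasis p * involute b = a + cliffordBasis p * b := by
        rw [← hab, ← hx, hab, map_add, map_mul, hp', neg_mul, sub_eq_add_neg]
      have h3 : (2 : ℝ) • (cliffordBasis p * involute b) = 0 := by
        rw [two_smul]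
        have := sub_eq_zero.2 (h1.trans h2.symm)
        rw [← this]; abel
      have h4 : cliffordBasis p * involute b = 0 :=
        (smul_eq_zero.1 h3).resolve_left (by norm_num)
      have h5 : involute b = 0 := hcancel _ _ (by rw [h4, mul_zero])
      have h6 : b = 0 := by rw [← involute_involute b, h5, map_zero]
      apply ih
      rw [hab, h6, mul_zero, add_zero]
      exact ha
  refine key Finset.univ ?_
  have htop : Algebra.adjoin ℝ (cliffordBasis '' ((Finset.univ : Finset (Fin n)) : Set (Fin n)))
      = ⊤ := by
    rw [eq_top_iff, ← adjoin_range_ι, Algebra.adjoin_le_iff]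
    rintro _ ⟨v, rfl⟩
    have : v = ∑ i, v i • (Pi.single i 1 : Fin n → ℝ) := by
      funext k
      simp [Finset.sum_apply, Pi.single_apply]
    rw [this, map_sum]
    refine sum_mem fun i _ => ?_
    rw [map_smul]
    exact Subalgebra.smul_mem _ (Algebra.subset_adjoin
      (Set.mem_image_of_mem cliffordBasis (Finset.mem_coe.2 (Finset.mem_univ i)))) _
  rw [htop]
  exact Algebra.mem_top

/-- Over the identity permutation x commutes with all eᵢ and is even, hence a scalar r. The spin
condition star x * x = 1 gives r² = 1. -/
theorem eq_one_or_eq_negSpin (hn : 0 < n) {x : SpinAlt n} (hx : spinAltProj n x = 1) :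
    x = 1 ∨ x = negSpin hn := by
  have h2 : x.1.2 = 1 := hx
  have hc : ∀ i, (x.1.1 : CliffordAlgebra (stdForm n)) * cliffordBasis i
      = cliffordBasis i * (x.1.1 : CliffordAlgebra (stdForm n)) := by
    intro i
    have := x.2 i
    rw [h2] at this
    exact this
  obtain ⟨r, hr⟩ := exists_eq_algebraMap_of_even_central (spinGroup.involute_eq x.1.1.2) hc
  have h := spinGroup.star_mul_self_of_mem x.1.1.2
  rw [hr, CliffordAlgebra.star_algebraMap, ← map_mul, ← map_one (algebraMap ℝ _)] at h
  have h' := (algebraMap ℝ (CliffordAlgebra (stdForm n))).injective h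
  rcases mul_self_eq_one_iff.1 h' with rfl | rfl
  · exact Or.inl (SpinAlt.ext' (hr.trans (map_one _)) h2)
  · exact Or.inr (SpinAlt.ext' (hr.trans (by rw [map_neg, map_one]; rfl)) h2)

end Spin

/-! ### Clifford words -/

section Words

variable {n : ℕ}

theorem negOne_central (x : CliffordWords n) : negOne n * x = x * negOne n := by
  have : (MulAut.conj (negOne n)).toMonoidHom = MonoidHom.id (CliffordWords n) :=
    cliffordHom_ext (by simp) fun i => by
      simp [negOne_comm]
  have := DFunLike.congr_fun this x
  simpa [mul_inv_eq_iff_eq_mul] using this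

theorem negOne_mul_self : negOne n * negOne n = 1 := by rw [← pow_two, negOne_sq]

/-- The Clifford words as elements of the Clifford algebra. -/
noncomputable def wordsToClifford (n : ℕ) : CliffordWords n →* (CliffordAlgebra (stdForm n))ˣ :=
  cliffordLift (-1) (fun i => ⟨cliffordBasis i, -cliffordBasis i,
      by rw [mul_neg, cliffordBasis_mul_self, neg_neg],
      by rw [neg_mul, cliffordBasis_mul_self, neg_neg]⟩)
    (by simp) (fun i => by simp)
    (fun i => Units.ext (by rw [pow_two]; exact cliffordBasis_mul_self i))
    (fun i j h => Units.ext (by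
      simpa using cliffordBasis_anticomm h))

/-- That the presentation does not collapse -1 is detected in the Clifford algebra. -/
theorem negOne_ne_one : negOne n ≠ 1 := by
  intro h
  have := congrArg (wordsToClifford n) h
  rw [wordsToClifford, cliffordLift_negOne, map_one] at this
  exact clifford_neg_one_ne_one (congrArg Units.val this)

/-- Modulo -1 the symbols are commuting involutions, separated by the coordinates of `wordClass`.
For n > 0 they generate Fₙ, since -1 is the square of a symbol. -/
theorem eq_one_or_eq_negOne (hn : 0 < n) {x : CliffordWords n} (hx : wordClass n x = 1) :
    x = 1 ∨ x = negOne n := by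
  have hnorm : (Subgroup.zpowers (negOne n)).Normal :=
    ⟨fun v hv g => by
      have : v * g = g * v := by
        rcases eq_one_or_eq_of_mem_zpowers negOne_mul_self hv with rfl | rfl
        · simp
        · exact negOne_central g
      rwa [← this, mul_inv_cancel_right]⟩
  have htop : Subgroup.closure ((symbol : Fin n → CliffordWords n) '' (Finset.univ : Finset (Fin n)))
      = ⊤ := by
    rw [eq_top_iff, ← PresentedGroup.closure_range_of, Subgroup.closure_le]
    have h : ∀ i : Fin n, symbol i ∈ Subgroup.closure
        ((symbol : Fin n → CliffordWords n) '' (Finset.univ : Finset (Fin n))) := fun i =>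
      Subgroup.subset_closure ⟨i, Finset.mem_coe.2 (Finset.mem_univ i), rfl⟩
    rintro _ ⟨o, rfl⟩
    cases o with
    | none =>
      have := Subgroup.pow_mem _ (h ⟨0, hn⟩) 2
      rwa [symbol_sq] at this
    | some i => exact h i
  let ev : Fin n → (BinaryWords n →* Multiplicative (ZMod 2)) := fun k =>
    { toFun := fun v => Multiplicative.ofAdd (v.toAdd k)
      map_one' := rfl
      map_mul' := fun _ _ => rfl }
  have hev : ∀ i j : Fin n, symbol j ∈ ((ev i).comp (wordClass n)).ker ↔ i ≠ j := by
    intro i j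
    rw [MonoidHom.mem_ker, MonoidHom.comp_apply, wordClass_symbol]
    change Multiplicative.ofAdd ((Pi.single j 1 : Fin n → ZMod 2) i) = 1 ↔ _
    rw [Pi.single_apply]
    by_cases h : i = j
    · simp only [h, if_true, ne_eq, not_true, iff_false]
      decide
    · simp [h]
  refine eq_one_or_eq_of_mem_zpowers negOne_mul_self
    (mem_of_mem_closure_involutions (Subgroup.zpowers (negOne n)) symbol
      (fun i => ((ev i).comp (wordClass n)).ker) Finset.univ (fun i _ => ?_) (fun i _ => ?_)
      (fun i _ j _ => ?_) (fun i _ j _ hij => ?_) (fun i _ => ?_) (htop ▸ Subgroup.mem_top x)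
      (fun i _ => ?_))
  · rw [Subgroup.zpowers_le, MonoidHom.mem_ker, MonoidHom.comp_apply, wordClass_negOne, map_one]
  · rw [← pow_two, symbol_sq]
    exact Subgroup.mem_zpowers _
  · by_cases hij : i = j
    · rw [hij, inv_mul_cancel]; exact Subgroup.one_mem _
    · rw [symbol_anticomm j i (Ne.symm hij), negOne_central, inv_mul_cancel_left]
      exact Subgroup.mem_zpowers _
  · rw [hev]; exact Ne.symm hij
  · rw [hev]; exact fun h => h rfl
  · rw [MonoidHom.mem_ker, MonoidHom.comp_apply, hx, map_one]

/-- The product (eᵢeⱼ)(eⱼeₖ) is -eᵢeₖ, whereas (eⱼeₖ)(eᵢeⱼ) is eᵢeₖ. -/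
theorem symbol_commutator {i j k : Fin n} (hij : i ≠ j) (hik : i ≠ k) (hjk : j ≠ k) :
    ⁅(symbol i * symbol j : CliffordWords n), symbol j * symbol k⁆ = negOne n := by
  have hm : ∀ x y : CliffordWords n, x * (negOne n * y) = negOne n * (x * y) := fun x y => by
    rw [← mul_assoc, ← negOne_central, mul_assoc]
  have hmm : ∀ x : CliffordWords n, negOne n * (negOne n * x) = x := fun x => by
    rw [← mul_assoc, negOne_mul_self, one_mul]
  have hss : ∀ (a : Fin n) (x : CliffordWords n), symbol a * (symbol a * x) = negOne n * x :=
    fun a x => by rw [← mul_assoc, ← pow_two, symbol_sq]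
  rw [commutatorElement_def, mul_assoc, ← mul_inv_rev, mul_inv_eq_iff_eq_mul]
  have h1 : symbol j * symbol k * (symbol i * symbol j) = (symbol i * symbol k : CliffordWords n) := by
    rw [symbol_anticomm i j hij, hm, mul_assoc, ← mul_assoc (symbol k),
      symbol_anticomm k j hjk.symm, mul_assoc (negOne n), hm, hmm, mul_assoc (symbol j), hss,
      symbol_anticomm k i hik.symm, hmm]
  rw [h1, mul_assoc, hss, hm]

end Words

/-! ### Integral orthogonal matrices -/

section Orthogonal

variable {n : ℕ}

theorem exists_of_sum_mul_self_eq_one {ι : Type*} [Fintype ι] [DecidableEq ι] {f : ι → ℤ}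
    (h : ∑ i, f i * f i = 1) : ∃ i, f i * f i = 1 ∧ ∀ k, k ≠ i → f k = 0 := by
  obtain ⟨i, hi⟩ : ∃ i, f i ≠ 0 := by
    by_contra! h0
    simp [h0] at h
  have h1 : 0 < f i * f i := mul_self_pos.2 hi
  have h2 := Finset.add_sum_erase Finset.univ (fun i => f i * f i) (Finset.mem_univ i)
  have h3 : 0 ≤ ∑ k ∈ Finset.univ.erase i, f k * f k :=
    Finset.sum_nonneg fun k _ => mul_self_nonneg _
  simp only [h] at h2
  have h4 : ∑ k ∈ Finset.univ.erase i, f k * f k = 0 := by omega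
  refine ⟨i, by omega, fun k hk => ?_⟩
  exact mul_self_eq_zero.1 ((Finset.sum_eq_zero_iff_of_nonneg fun k _ => mul_self_nonneg _).1 h4 k
    (Finset.mem_erase.2 ⟨hk, Finset.mem_univ k⟩))

theorem toOrthogonal_injective (n : ℕ) : Function.Injective (toOrthogonal n) := by
  rw [injective_iff_map_eq_one]
  intro g hg
  have h1 : ∀ i j, signedMatrix n g i j = (1 : Matrix (Fin n) (Fin n) ℤ) i j := fun i j =>
    congrFun (congrFun (congrArg Subtype.val hg) i) j
  have h2 : ∀ j, j = g.right j ∧ g.left.toAdd j = 0 := by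
    intro j
    have h := h1 j j
    simp only [signedMatrix, Matrix.of_apply, Matrix.one_apply_eq] at h
    by_cases hj : j = g.right j
    · rw [if_pos hj] at h
      refine ⟨hj, ?_⟩
      revert h
      generalize g.left.toAdd j = a
      revert a
      decide
    · rw [if_neg hj] at h
      exact absurd h (by decide)
  refine SemidirectProduct.ext ?_ ?_
  · apply Multiplicative.toAdd.injective
    funext j
    exact (h2 j).2
  · ext j
    rw [← (h2 j).1]; rfl

/-- Each column is an integral unit vector, so it has a single nonzero entry, equal to ±1.
Orthogonality of distinct columns puts these entries in distinct rows, which defines the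
permutation. -/
theorem toOrthogonal_surjective (n : ℕ) : Function.Surjective (toOrthogonal n) := by
  rintro ⟨A, hA⟩
  rw [Matrix.mem_orthogonalGroup_iff'] at hA
  have hcol : ∀ j k, ∑ i, A i j * A i k = (1 : Matrix (Fin n) (Fin n) ℤ) j k := by
    intro j k
    rw [← hA, Matrix.mul_apply]
    rfl
  choose σ hσ hσ' using fun j => exists_of_sum_mul_self_eq_one (f := fun i => A i j)
    ((hcol j j).trans (Matrix.one_apply_eq j))
  have hinj : Function.Injective σ := by
    intro j k hjk
    by_contra hne
    have h := hcol j k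
    rw [Matrix.one_apply_ne hne, Finset.sum_eq_single (σ j)
      (fun i _ hi => by rw [hσ' j i hi, zero_mul]) (by simp)] at h
    have h1 := hσ j
    have h2 := hσ k
    rw [← hjk] at h2
    rcases mul_eq_zero.1 h with h | h
    · simp [h] at h1
    · simp [h] at h2
  let τ : Equiv.Perm (Fin n) := Equiv.ofBijective σ (Finite.injective_iff_bijective.1 hinj)
  refine ⟨⟨Multiplicative.ofAdd fun i => if A i (τ.symm i) = 1 then 0 else 1, τ⟩, Subtype.ext ?_⟩
  ext i j
  change (if i = σ j then sgn (if A i (τ.symm i) = 1 then 0 else 1) else 0) = A i j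
  by_cases h : i = σ j
  · have hs : τ.symm i = j := by rw [h]; exact τ.symm_apply_apply j
    rw [if_pos h, hs]
    have h1 := hσ j
    simp only [← h] at h1
    rcases mul_self_eq_one_iff.1 h1 with h1 | h1
    · rw [h1, if_pos rfl]; rfl
    · rw [h1, if_neg (by decide)]; rfl
  · rw [if_neg h, hσ' j i h]

theorem evenSignedInclusion_injective (n : ℕ) : Function.Injective (evenSignedInclusion n) := by
  intro g h hgh
  exact SemidirectProduct.ext (Subtype.ext (congrArg SemidirectProduct.left hgh))
    (Subtype.ext (congrArg SemidirectProduct.right hgh))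

theorem pairVec_mul_pairVec (i j k : Fin n) : pairVec i k * pairVec j k = pairVec i j := by
  refine evenBinary_ext fun l => ?_
  rw [map_mul, evenCoord_pairVec, evenCoord_pairVec, evenCoord_pairVec, ← ofAdd_add,
    add_add_add_comm, CharTwo.add_self_eq_zero, add_zero]

/-- If an even permutation fixes a and moves 0 to i, its commutator with e₀ + eₐ is eᵢ + e₀. These
vectors generate the even vectors, and Aₙ is perfect. -/
theorem evenSignedAlt_isPerfect (hn : 8 ≤ n) : Group.IsPerfect (EvenSignedAlt n) := by
  rw [Group.isPerfect_def, eq_top_iff]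
  intro g _
  rw [← SemidirectProduct.inl_left_mul_inr_right g]
  refine Subgroup.mul_mem _ ?_ ?_
  · have hle : (⊤ : Subgroup (evenBinary n)) ≤ (commutator (EvenSignedAlt n)).comap
        SemidirectProduct.inl := by
      rw [← closure_pairVec_eq_top (⟨0, by omega⟩ : Fin n), Subgroup.closure_le]
      rintro _ ⟨i, hi, rfl⟩
      obtain ⟨a, ha⟩ := exists_notMem_of_card (n := n) (s := {i, ⟨0, by omega⟩})
        (lt_of_le_of_lt Finset.card_le_two (by omega))
      simp only [Finset.mem_insert, Finset.mem_singleton, not_or] at ha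
      obtain ⟨x, hx, hx'⟩ := exists_alternating_pair hn (Ne.symm ha.2) (Ne.symm ha.1)
      have h1 := Subgroup.commutator_mem_commutator
        (Subgroup.mem_top (SemidirectProduct.inr x : EvenSignedAlt n))
        (Subgroup.mem_top (SemidirectProduct.inl (pairVec ⟨0, by omega⟩ a)))
      have h2 := inr_mul_pairVec x ⟨0, by omega⟩ a
      rw [hx, hx'] at h2
      rw [commutatorElement_def, ← h2, ← map_inv, ← map_mul] at h1
      have h3 : (pairVec (⟨0, by omega⟩ : Fin n) a)⁻¹ = pairVec ⟨0, by omega⟩ a := by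
        rw [inv_eq_iff_mul_eq_one, pairVec_mul_pairVec, pairVec_self]
      rw [h3, pairVec_mul_pairVec] at h1
      exact h1
    exact hle (Subgroup.mem_top g.left)
  · have h : g.right ∈ commutator (alternatingGroup (Fin n)) := by
      rw [alternating_isPerfect hn]; exact Subgroup.mem_top _
    have h2 := Subgroup.mem_map_of_mem (SemidirectProduct.inr : _ →* EvenSignedAlt n) h
    rw [commutator_def, Subgroup.map_commutator] at h2
    exact Subgroup.commutator_mono le_top le_top h2

/-- The sign of the permutation and the coordinate sum, which is invariant under permutations, are
characters that vanish on commutators. Conversely, their common kernel is perfect. -/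
theorem commutator_signedPerm (hn : 8 ≤ n) :
    commutator (SignedPerm n) = (evenSignedInclusion n).range := by
  apply le_antisymm
  · intro g hg
    have h1 := Abelianization.commutator_subset_ker
      ((Equiv.Perm.sign).comp (SemidirectProduct.rightHom : SignedPerm n →* _)) hg
    have h2 := Abelianization.commutator_subset_ker (SemidirectProduct.lift (φ := permBinary n)
      (coordSum n) (1 : Equiv.Perm (Fin n) →* Multiplicative (ZMod 2)) (fun σ => by
        refine MonoidHom.ext fun v => ?_
        simpa using coordSum_permBinary n σ v)) hg
    rw [MonoidHom.mem_ker] at h1 h2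
    simp [SemidirectProduct.lift] at h2
    exact ⟨⟨⟨g.left, h2⟩, ⟨g.right, h1⟩⟩, rfl⟩
  · have := evenSignedAlt_isPerfect hn
    rw [MonoidHom.range_eq_map, ← this.commutator_eq_top, commutator_def, Subgroup.map_commutator]
    exact Subgroup.commutator_mono le_top le_top

theorem range_eq_commutator (hn : 8 ≤ n) :
    ((toOrthogonal n).comp (evenSignedInclusion n)).range
      = commutator (Matrix.orthogonalGroup (Fin n) ℤ) := by
  rw [MonoidHom.range_comp, ← commutator_signedPerm hn, commutator_def, commutator_def,
    Subgroup.map_commutator, ← MonoidHom.range_eq_map,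
    MonoidHom.range_eq_top.2 (toOrthogonal_surjective n)]

end Orthogonal

/-! ### The universal central extension -/

section Universal

variable {n : ℕ}

/-- The element `-1` of `Fₙᵉᵛ`. -/
def negEven (n : ℕ) : evenClifford n :=
  ⟨negOne n, by
    rw [evenClifford, Subgroup.mem_comap, wordClass_negOne]
    exact Subgroup.one_mem _⟩

/-- The word `eᵢ eⱼ` of `Fₙᵉᵛ`. -/
def pairWord (i j : Fin n) : evenClifford n :=
  ⟨symbol i * symbol j, by
    rw [evenClifford, Subgroup.mem_comap, map_mul, wordClass_symbol, wordClass_symbol]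
    exact (pairVec i j).2⟩

theorem evenWordClass_pairWord (i j : Fin n) : evenWordClass n (pairWord i j) = pairVec i j := by
  apply Subtype.ext
  change wordClass n (symbol i * symbol j) = _
  rw [map_mul, wordClass_symbol, wordClass_symbol]
  rfl

theorem evenWordClass_negEven : evenWordClass n (negEven n) = 1 :=
  Subtype.ext (wordClass_negOne n)

theorem spinAltClifford_eq_one {s : SpinAlt n} (hs : spinAltProj n s = 1) :
    spinAltClifford n s = 1 := by
  change ((restrictAction (permClifford n) (evenClifford n) (permClifford_mem_even n)).comp
    (alternatingGroup (Fin n)).subtype) (spinAltProj n s) = 1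
  rw [hs, map_one]

theorem spinAltClifford_negEven (s : SpinAlt n) :
    spinAltClifford n s (negEven n) = negEven n :=
  Subtype.ext (permCliffordHom_negOne (spinAltProj n s : Equiv.Perm (Fin n)))

theorem inl_negEven_comm (e : SpinEvenClifford n) :
    e * SemidirectProduct.inl (negEven n) = SemidirectProduct.inl (negEven n) * e := by
  refine SemidirectProduct.ext ?_ ?_
  · rw [SemidirectProduct.mul_left, SemidirectProduct.mul_left, SemidirectProduct.left_inl,
      SemidirectProduct.right_inl, map_one, spinAltClifford_negEven]
    exact Subtype.ext (negOne_central _).symm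
  · simp

theorem inr_negSpin_comm (hn : 0 < n) (e : SpinEvenClifford n) :
    e * SemidirectProduct.inr (negSpin hn) = SemidirectProduct.inr (negSpin hn) * e := by
  refine SemidirectProduct.ext ?_ ?_
  · rw [SemidirectProduct.mul_left, SemidirectProduct.mul_left, SemidirectProduct.left_inr,
      SemidirectProduct.right_inr, spinAltClifford_eq_one (s := negSpin hn) rfl, map_one]
    simp
  · exact (negSpin_comm hn _).symm

theorem towerProj_eq_one (hn : 0 < n) {e : SpinEvenClifford n} (he : towerProj n e = 1) :
    e = 1 ∨ e = SemidirectProduct.inl (negEven n) ∨ e = SemidirectProduct.inr (negSpin hn) ∨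
      e = SemidirectProduct.inl (negEven n) * SemidirectProduct.inr (negSpin hn) := by
  have h1 : wordClass n e.left = 1 :=
    congrArg (fun g : EvenSignedAlt n => (g.left : BinaryWords n)) he
  have h2 : spinAltProj n e.right = 1 := congrArg SemidirectProduct.right he
  rw [← SemidirectProduct.inl_left_mul_inr_right e]
  have h1' : e.left = 1 ∨ e.left = negEven n :=
    (eq_one_or_eq_negOne hn h1).imp (fun h => Subtype.ext h) fun h => Subtype.ext h
  rcases h1' with h1 | h1 <;> rcases eq_one_or_eq_negSpin hn h2 with h2 | h2 <;>
    simp [h1, h2]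

theorem towerProj_inl_negEven : towerProj n (SemidirectProduct.inl (negEven n)) = 1 := by
  rw [towerProj, SemidirectProduct.map_inl, evenWordClass_negEven, map_one]

theorem towerProj_inr_negSpin (hn : 0 < n) :
    towerProj n (SemidirectProduct.inr (negSpin hn)) = 1 := by
  rw [towerProj, SemidirectProduct.map_inr, show spinAltProj n (negSpin hn) = 1 from rfl, map_one]

theorem towerProj_surjective (hn : 8 ≤ n) : Function.Surjective (towerProj n) := by
  intro g
  obtain ⟨s, hs⟩ := spinAltProj_surjective hn g.right
  have htop : (evenWordClass n).range = ⊤ := by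
    rw [eq_top_iff, ← closure_pairVec_eq_top (⟨0, by omega⟩ : Fin n), Subgroup.closure_le]
    rintro _ ⟨i, -, rfl⟩
    exact ⟨_, evenWordClass_pairWord i _⟩
  obtain ⟨x, hx⟩ := MonoidHom.range_eq_top.1 htop g.left
  exact ⟨⟨x, s⟩, SemidirectProduct.ext hx hs⟩

theorem towerProj_isCentralExtension (hn : 8 ≤ n) : IsCentralExtension (towerProj n) := by
  refine ⟨towerProj_surjective hn, fun e he => ?_⟩
  rw [Subgroup.mem_center_iff]
  intro g
  have hn0 : 0 < n := by omega
  rcases towerProj_eq_one hn0 he with rfl | rfl | rfl | rfl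
  · simp
  · exact inl_negEven_comm g
  · exact inr_negSpin_comm hn0 g
  · rw [← mul_assoc, inl_negEven_comm, mul_assoc, inr_negSpin_comm, mul_assoc]

theorem negEven_mul_self : negEven n * negEven n = 1 := Subtype.ext negOne_mul_self

theorem mul_self_eq_one_of_towerProj (hn : 0 < n) {e : SpinEvenClifford n}
    (he : towerProj n e = 1) : e * e = 1 := by
  have h1 : (SemidirectProduct.inl (negEven n) : SpinEvenClifford n)
      * SemidirectProduct.inl (negEven n) = 1 := by
    rw [← map_mul, negEven_mul_self, map_one]
  have h2 : (SemidirectProduct.inr (negSpin hn) : SpinEvenClifford n)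
      * SemidirectProduct.inr (negSpin hn) = 1 := by
    rw [← map_mul, negSpin_mul_self, map_one]
  rcases towerProj_eq_one hn he with rfl | rfl | rfl | rfl
  · simp
  · exact h1
  · exact h2
  · rw [mul_assoc, ← mul_assoc (SemidirectProduct.inr (negSpin hn)), inl_negEven_comm,
      mul_assoc (SemidirectProduct.inl (negEven n)), h2, mul_one, h1]

/-- Two lifts differ by a central element of square 1, so all have the same square, which is
computed on the spin lift. -/
theorem mul_self_of_lift_doubleSwap (hn : 8 ≤ n) {a b c d : Fin n} (hab : a ≠ b) (hcd : c ≠ d)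
    (hac : a ≠ c) (had : a ≠ d) (hbc : b ≠ c) (hbd : b ≠ d) {e : SpinEvenClifford n}
    (he : towerProj n e = SemidirectProduct.inr (doubleSwap a b c d)) :
    e * e = SemidirectProduct.inr (negSpin (by omega)) := by
  have h0 : towerProj n (SemidirectProduct.inr (spinDoubleSwap hab hcd))
      = SemidirectProduct.inr (doubleSwap a b c d) := by
    rw [towerProj, SemidirectProduct.map_inr, spinAltProj_spinDoubleSwap]
  obtain ⟨k, hk, rfl, hk'⟩ := (towerProj_isCentralExtension hn).exists_eq_mul (he.trans h0.symm)
  rw [mul_assoc, ← mul_assoc _ k, hk', mul_assoc k, ← mul_assoc k,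
    mul_self_eq_one_of_towerProj (by omega) hk, one_mul, ← map_mul,
    spinDoubleSwap_mul_self (by omega) hab hcd hac had hbc hbd]

theorem commutator_of_lift_pairVec (hn : 8 ≤ n) {i j k : Fin n} (hij : i ≠ j) (hik : i ≠ k)
    (hjk : j ≠ k) {s t : SpinEvenClifford n}
    (hs : towerProj n s = SemidirectProduct.inl (pairVec i j))
    (ht : towerProj n t = SemidirectProduct.inl (pairVec j k)) :
    ⁅s, t⁆ = SemidirectProduct.inl (negEven n) := by
  have h0 : ∀ i j : Fin n, towerProj n (SemidirectProduct.inl (pairWord i j))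
      = SemidirectProduct.inl (pairVec i j) := fun i j => by
    rw [towerProj, SemidirectProduct.map_inl, evenWordClass_pairWord]
  rw [(towerProj_isCentralExtension hn).commutator_eq (hs.trans (h0 i j).symm)
    (ht.trans (h0 j k).symm), ← map_commutatorElement]
  exact congrArg SemidirectProduct.inl (Subtype.ext (symbol_commutator hij hik hjk))

/-- As the base is perfect, each element is a product of commutators up to the kernel, and both
generators of the kernel are commutators. -/
theorem spinEvenClifford_commutator (hn : 8 ≤ n) : commutator (SpinEvenClifford n) = ⊤ := by
  have hn0 : 0 < n := by omega
  rw [eq_top_iff]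
  intro e _
  have hG := (evenSignedAlt_isPerfect hn).commutator_eq_top
  have hmap : (commutator (SpinEvenClifford n)).map (towerProj n) = ⊤ := by
    rw [commutator_def, Subgroup.map_commutator, ← MonoidHom.range_eq_map,
      MonoidHom.range_eq_top.2 (towerProj_surjective hn), ← commutator_def, hG]
  obtain ⟨e', he', hee⟩ : towerProj n e ∈ (commutator (SpinEvenClifford n)).map (towerProj n) := by
    rw [hmap]; exact Subgroup.mem_top _
  obtain ⟨k, hk, rfl, -⟩ := (towerProj_isCentralExtension hn).exists_eq_mul hee.symm
  refine Subgroup.mul_mem _ ?_ he'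
  have h1 : SemidirectProduct.inl (negEven n) ∈ commutator (SpinEvenClifford n) := by
    obtain ⟨s, hs⟩ := towerProj_surjective hn
      (SemidirectProduct.inl (pairVec ⟨0, by omega⟩ ⟨1, by omega⟩))
    obtain ⟨t, ht⟩ := towerProj_surjective hn
      (SemidirectProduct.inl (pairVec ⟨1, by omega⟩ ⟨2, by omega⟩))
    rw [← commutator_of_lift_pairVec hn (by simp) (by simp) (by simp) hs ht]
    exact Subgroup.commutator_mem_commutator (Subgroup.mem_top _) (Subgroup.mem_top _)
  have h2 : SemidirectProduct.inr (negSpin hn0) ∈ commutator (SpinEvenClifford n) := by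
    rw [← spinDoubleSwap_commutator hn0 (a := ⟨0, by omega⟩) (b := ⟨1, by omega⟩)
      (c := ⟨2, by omega⟩) (d := ⟨3, by omega⟩) (e := ⟨4, by omega⟩) (f := ⟨5, by omega⟩)
      (by simp) (by simp) (by simp) (by simp) (by simp) (by simp) (by simp) (by simp) (by simp)
      (by simp) (by simp) (by simp) (by simp) (by simp) (by simp), map_commutatorElement]
    exact Subgroup.commutator_mem_commutator (Subgroup.mem_top _) (Subgroup.mem_top _)
  rcases towerProj_eq_one hn0 hk with rfl | rfl | rfl | rfl
  · exact Subgroup.one_mem _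
  · exact h1
  · exact h2
  · exact Subgroup.mul_mem _ h1 h2

theorem inl_negEven_ne_one : (SemidirectProduct.inl (negEven n) : SpinEvenClifford n) ≠ 1 := by
  intro h
  exact negOne_ne_one (n := n) (congrArg (fun e : SpinEvenClifford n =>
    (e.left : CliffordWords n)) h)

theorem inr_negSpin_ne_one (hn : 0 < n) :
    (SemidirectProduct.inr (negSpin hn) : SpinEvenClifford n) ≠ 1 := fun h =>
  negSpin_ne_one hn (congrArg SemidirectProduct.right h)

theorem inl_mul_inr_ne_one (hn : 0 < n) :
    (SemidirectProduct.inl (negEven n) * SemidirectProduct.inr (negSpin hn) : SpinEvenClifford n)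
      ≠ 1 := fun h =>
  negSpin_ne_one hn (by simpa using congrArg SemidirectProduct.right h)

/-- Homomorphisms over `G` from a perfect group to a central extension of `G` are unique. -/
theorem IsCentralExtension.hom_unique {E X G : Type*} [Group E] [Group X] [Group G]
    (hE : commutator E = ⊤) {q : X →* G} (hq : IsCentralExtension q) {f f' : E →* X}
    (h : q.comp f = q.comp f') : f = f' := by
  have hle : commutator E ≤ f.eqLocus f' := by
    rw [commutator_def, Subgroup.commutator_le]
    intro x _ y _
    change f ⁅x, y⁆ = f' ⁅x, y⁆
    rw [map_commutatorElement, map_commutatorElement]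
    exact hq.commutator_eq (DFunLike.congr_fun h x) (DFunLike.congr_fun h y)
  ext x
  have : x ∈ f.eqLocus f' := hle (by rw [hE]; exact Subgroup.mem_top x)
  exact this

/-- The covering subgroup K of the fibre product X ×_G E is the graph of the required map, because
it projects isomorphically to E. -/
theorem exists_lift_towerProj (hn : 8 ≤ n) {X : Type w} [Group X] {q : X →* EvenSignedAlt n}
    (hq : IsCentralExtension q) : ∃ f : SpinEvenClifford n →* X, q.comp f = towerProj n := by
  have hn0 : 0 < n := by omega
  set p := towerProj n with hp
  have hpc : IsCentralExtension p := towerProj_isCentralExtension hn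
  let Y : Subgroup (X × SpinEvenClifford n) :=
    (q.comp (MonoidHom.fst X (SpinEvenClifford n))).eqLocus (p.comp (MonoidHom.snd X _))
  let π₁ : Y →* X := (MonoidHom.fst _ _).comp Y.subtype
  let π₂ : Y →* SpinEvenClifford n := (MonoidHom.snd _ _).comp Y.subtype
  have hY : ∀ y : Y, q (π₁ y) = p (π₂ y) := fun y => y.2
  have hYc : IsCentralExtension (p.comp π₂) := by
    refine ⟨fun g => ?_, fun y hy => ?_⟩
    · obtain ⟨x, hx⟩ := hq.1 g
      obtain ⟨e, he⟩ := hpc.1 g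
      exact ⟨⟨(x, e), hx.trans he.symm⟩, he⟩
    · rw [Subgroup.mem_center_iff]
      intro u
      have h2 : p (π₂ y) = 1 := hy
      exact Subtype.ext (Prod.ext (hq.comm ((hY y).trans h2) _) (hpc.comm h2 _))
  obtain ⟨K, z, c, hK, hker, ⟨d, hd, hz⟩, s, t, hs, ht, hc⟩ := exists_covering_subgroup hn hYc
    (i₀ := ⟨0, by omega⟩) (a := ⟨1, by omega⟩) (j₀ := ⟨2, by omega⟩) (b := ⟨3, by omega⟩)
    (by simp)
  have hz2 : π₂ z = SemidirectProduct.inr (negSpin hn0) := by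
    rw [hz, map_mul]
    exact mul_self_of_lift_doubleSwap hn (by simp) (by simp) (by simp) (by simp) (by simp)
      (by simp) hd
  have hc2 : π₂ c = SemidirectProduct.inl (negEven n) := by
    rw [hc, map_commutatorElement]
    exact commutator_of_lift_pairVec hn (by simp) (by simp) (by simp) hs ht
  -- The elements z, c and zc of the kernel of K → G have nontrivial images in E, so none of them
  -- can represent a nontrivial element of the kernel of K → E.
  have hinj : Function.Injective (π₂.comp K.subtype) := by
    rw [injective_iff_map_eq_one]
    intro k hk
    have hk' : π₂ k = 1 := hk
    have h1 : (p.comp π₂) k = 1 := by rw [MonoidHom.comp_apply, hk', map_one]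
    apply Subtype.ext
    rcases hker k k.2 h1 with h | h | h | h
    · exact h
    · rw [h, hz2] at hk'
      exact absurd hk' (inr_negSpin_ne_one hn0)
    · rw [h, hc2] at hk'
      exact absurd hk' inl_negEven_ne_one
    · rw [h, map_mul, hz2, hc2, inl_negEven_comm] at hk'
      exact absurd hk' (inl_mul_inr_ne_one hn0)
  -- K covers G and commutators in E depend only on images in G, so the image of K contains all
  -- commutators of the perfect group E.
  have hsurj : Function.Surjective (π₂.comp K.subtype) := by
    rw [← MonoidHom.range_eq_top, eq_top_iff, ← spinEvenClifford_commutator hn, commutator_def,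
      Subgroup.commutator_le]
    intro x _ y _
    have hlift : ∀ x, ∃ k ∈ K, p (π₂ k) = p x := by
      intro x
      have : p x ∈ K.map (p.comp π₂) := by rw [hK]; exact Subgroup.mem_top _
      exact this
    obtain ⟨k, hk, hkx⟩ := hlift x
    obtain ⟨l, hl, hly⟩ := hlift y
    rw [← hpc.commutator_eq hkx hly, ← map_commutatorElement]
    exact ⟨⁅(⟨k, hk⟩ : K), (⟨l, hl⟩ : K)⁆, rfl⟩
  let φ := MulEquiv.ofBijective (π₂.comp K.subtype) ⟨hinj, hsurj⟩
  refine ⟨(π₁.comp K.subtype).comp φ.symm.toMonoidHom, MonoidHom.ext fun e => ?_⟩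
  have := hY (φ.symm e : K)
  exact this.trans (congrArg p (φ.apply_symm_apply e))

theorem towerProj_isUniversal (hn : 8 ≤ n) :
    IsUniversalCentralExtension.{0, 0, w} (towerProj n) := by
  refine ⟨towerProj_isCentralExtension hn, fun X _ q hq => ?_⟩
  obtain ⟨f, hf⟩ := exists_lift_towerProj hn hq
  exact ⟨f, hf, fun g hg =>
    hq.hom_unique (spinEvenClifford_commutator hn) (hg.trans hf.symm)⟩

open SemidirectProduct in
theorem ker_towerProj (hn : 8 ≤ n) :
    Nonempty ((towerProj n).ker ≃* Multiplicative (ZMod 2) × Multiplicative (ZMod 2)) := by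
  have hn0 : 0 < n := by omega
  set z : SpinEvenClifford n := inr (negSpin hn0) with hz
  set c : SpinEvenClifford n := inl (negEven n) with hc
  have hset : ((towerProj n).ker : Set (SpinEvenClifford n)) = ({1, c, z, c * z} : Set _) := by
    ext e
    simp only [SetLike.mem_coe, MonoidHom.mem_ker, Set.mem_insert_iff, Set.mem_singleton_iff]
    refine ⟨towerProj_eq_one hn0, ?_⟩
    rintro (rfl | rfl | rfl | rfl)
    · exact map_one _
    · exact towerProj_inl_negEven
    · exact towerProj_inr_negSpin hn0
    · rw [map_mul, towerProj_inl_negEven, towerProj_inr_negSpin, one_mul]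
  have hz1 : z ≠ 1 := inr_negSpin_ne_one hn0
  have hc1 : c ≠ 1 := inl_negEven_ne_one
  have hcz1 : c * z ≠ 1 := inl_mul_inr_ne_one hn0
  have hzz : z * z = 1 := mul_self_eq_one_of_towerProj hn0 (towerProj_inr_negSpin hn0)
  have hcz : c ≠ z := fun h => hcz1 (by rw [h, hzz])
  have hcard : Nat.card (towerProj n).ker = 4 := by
    change Nat.card ((towerProj n).ker : Set (SpinEvenClifford n)) = 4
    rw [hset, Nat.card_coe_set_eq]
    classical
    rw [show ({1, c, z, c * z} : Set (SpinEvenClifford n))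
      = (({1, c, z, c * z} : Finset (SpinEvenClifford n)) : Set _) by simp, Set.ncard_coe_finset,
      Finset.card_insert_of_notMem, Finset.card_insert_of_notMem, Finset.card_insert_of_notMem,
      Finset.card_singleton]
    · simpa using hc1
    · simp only [Finset.mem_insert, Finset.mem_singleton, not_or]
      exact ⟨hcz, by simpa using hz1⟩
    · simp only [Finset.mem_insert, Finset.mem_singleton, not_or]
      exact ⟨hc1.symm, hz1.symm, hcz1.symm⟩
  -- A group of order four and exponent two is determined up to isomorphism.
  have hK : IsKleinFour (towerProj n).ker := by
    refine ⟨hcard, ?_⟩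
    have : Nontrivial (towerProj n).ker :=
      ⟨⟨z, towerProj_inr_negSpin hn0⟩, 1, fun h => hz1 (congrArg Subtype.val h)⟩
    refine (Monoid.exponent_eq_prime_iff Nat.prime_two).2 fun g hg => orderOf_eq_prime ?_ hg
    rw [pow_two]
    exact Subtype.ext (mul_self_eq_one_of_towerProj hn0 g.2)
  have hK' : IsKleinFour (Multiplicative (ZMod 2 × ZMod 2)) := inferInstance
  obtain ⟨e⟩ := IsKleinFour.nonempty_mulEquiv (G₁ := (towerProj n).ker)
    (G₂ := Multiplicative (ZMod 2 × ZMod 2))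
  exact ⟨e.trans (MulEquiv.prodMultiplicative _ _)⟩

end Universal

end HyperoctahedralTower

theorem mainTheorem4 (n : ℕ) (hn : 8 ≤ n) :
    Function.Bijective (toOrthogonal n) ∧
      IsWhiteheadTowerStart.{0, 0, 0, w}
        ((toOrthogonal n).comp (evenSignedInclusion n)) (towerProj n) ∧
      Nonempty ((towerProj n).ker ≃* Multiplicative (ZMod 2) × Multiplicative (ZMod 2)) :=
  ⟨⟨toOrthogonal_injective n, toOrthogonal_surjective n⟩,
    ⟨(toOrthogonal_injective n).comp (evenSignedInclusion_injective n), range_eq_commutator hn,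
      evenSignedAlt_isPerfect hn, towerProj_isUniversal hn⟩,
    ker_towerProj hn⟩
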